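/- **Conventions.** For a symmetric bilinear form $B$ on a finite-dimensional real vector space, $\mathrm{sign}(B)=n_-(B)-n_+(B)$, where $n_-(B)$ and $n_+(B)$ are the maximal dimensions of subspaces on which $B$ is negative, resp. positive, definite. For a symplectic space $(E,\Omega)$ (finite-dimensional, real), $\Lambda(E,\Omega)$ is its Lagrangian Grassmannian. If $L_0,L_1\in\Lambda$ are complementary and $L\in\Lambda$ is transverse to $L_1$, then $L$ is the graph of a unique linear map $T:L_0\to L_1$, and $\varphi_{L_0,L_1}(L)$ is the symmetric bilinear form $\Omega(T\cdot,\cdot)$ on $L_0$. The $L_0$-Maslov index $\mu_{L_0}$ is the unique $\tfrac12\mathbb Z$-valued groupoid homomorphism on the fundamental groupoid of $\Lambda(E,\Omega)$ with $$\mu_{L_0}([\gamma])=\tfrac12\,\mathrm{sign}\,\varphi_{L_0,L_1}(\gamma(1))-\tfrac12\,\mathrm{sign}\,\varphi_{L_0,L_1}(\gamma(0))$$ for every $L_1\in\Lambda$ transverse to $L_0$ and every continuous curve $\gamma:[0,1]\to\Lambda$ all of whose values are transverse to $L_1$. For $L_0,L_1,L_0',L_1'\in\Lambda$ the Hörmander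 index is $\mathfrak q(L_0,L_1;L_0',L_1')=\mu_{L_1}([\gamma])-\mu_{L_0}([\gamma])$, where $\gamma$ is any continuous curve in $\Lambda$ from $L_0'$ to $L_1'$ (the value does not depend on $\gamma$). **Setting.** Let $(V,\omega)$ be a finite-dimensional real symplectic space, endowed with a positive definite inner product $\langle\cdot,\cdot\rangle$ and a complex structure $J$ (i.e. $J^2=-\mathrm{Id}$) such that $\langle J\cdot,\cdot\rangle=\omega$. The signature of a symmetric operator $A$ on $V$ is that of $\langle A\cdot,\cdot\rangle$. On $V^2=V\oplus V$ consider the symplectic form $\omega^2\big((v_1,v_2),(w_1,w_2)\big)=\omega(v_1,w_1)-\omega(v_2,w_2)$; for $\phi\in\mathrm{Sp}(V,\omega)$ the graph $\mathrm{Gr}(\phi)=\{(v,\phi v):v\in V\}$ is Lagrangian in $(V^2,\omega^2)$; let $\Delta=\mathrm{Gr}(\mathrm{Id})$. For $\psi\in\mathrm{Sp}(V,\omega)$ let $\mathrm{Sp}_\psi(V,\omega)$ be the set of $\Phi\in\mathrm{Sp}(V,\omega)$ with $\Phi-\psi$ invertible, and $\mathrm{Sp}_0(V,\omega)=\mathrm{Sp}_{\mathrm{Id}}(V,\omega)$.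 For $\psi\in\mathrm{Sp}_0(V,\omega)$ and $\Phi\in\mathrm{Sp}_\psi(V,\omega)$ the $\psi$-Cayley transform of $\Phi$ is the symmetric operator $$\mathcal C_\psi(\Phi)=J(\psi-\mathrm{Id})(\Phi-\psi)^{-1}(\Phi-\mathrm{Id}).$$ **Proposition.** Let $\psi\in\mathrm{Sp}_0(V,\omega)$ and $\phi_1,\phi_2\in\mathrm{Sp}_\psi(V,\omega)$. Then the Hörmander index in $\Lambda(V^2,\omega^2)$ is $$\mathfrak q\big(\Delta,\mathrm{Gr}(\phi_1);\Delta,\mathrm{Gr}(\phi_2)\big)=\tfrac12\Big[\mathrm{sign}\big(\mathcal C_\psi(\phi_2)-\mathcal C_\psi(\phi_1)\big)-\mathrm{sign}\big(\mathcal C_\psi(\phi_2)\big)+\mathrm{sign}\big(\mathcal C_\psi(\phi_1)\big)\Big].$$ If moreover $\phi_1,\phi_2\in\mathrm{Sp}_0(V,\omega)$, then $\mathcal C_\psi(\phi_1)$ and $\mathcal C_\psi(\phi_2)$ are invertible and $$\mathfrak q\big(\Delta,\mathrm{Gr}(\phi_1);\Delta,\mathrm{Gr}(\phi_2)\big)=\tfrac12\,\mathrm{sign}\big(\mathcal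 C_\psi(\phi_1)^{-1}-\mathcal C_\psi(\phi_2)^{-1}\big).$$ -/

import Mathlib

noncomputable section

namespace SymplecticIndex

/-! ### Signatures -/

/-- The signature of a real bilinear form, with the convention
`sign B = n₋(B) - n₊(B)` (index minus coindex). Here `n₋`, `n₊` are the maximal dimensions of
subspaces on which `B` is negative, respectively positive, definite. -/
def signForm {W : Type*} [AddCommGroup W] [Module ℝ W] (B : LinearMap.BilinForm ℝ W) : ℤ :=
  (sigNeg (LinearMap.BilinMap.toQuadraticMap B) : ℤ)
    - (sigPos (LinearMap.BilinMap.toQuadraticMap B) : ℤ)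

/-- The signature (same convention) of an operator `A` on a Euclidean space, identified with the
bilinear form `⟨A ·, ·⟩`. -/
def signOp {V : Type*} [NormedAddCommGroup V] [InnerProductSpace ℝ V] (A : Module.End ℝ V) : ℤ :=
  signForm ((innerₗ V) ∘ₗ A : LinearMap.BilinForm ℝ V)

section Lagrangians

variable {E : Type*} [AddCommGroup E] [Module ℝ E]

/-- A symplectic form: a nondegenerate antisymmetric bilinear form. -/
structure IsSymplectic (Ω : LinearMap.BilinForm ℝ E) : Prop where
  alt : Ω.IsAlt
  nondegenerate : Ω.Nondegenerate

/-- A subspace is Lagrangian if the form vanishes on it and its dimension is half of `dim E`. -/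
def IsLagrangian (Ω : LinearMap.BilinForm ℝ E) (L : Submodule ℝ E) : Prop :=
  (∀ x ∈ L, ∀ y ∈ L, Ω x y = 0) ∧ 2 * Module.finrank ℝ L = Module.finrank ℝ E

/-- The Lagrangian Grassmannian `Λ(E, Ω)`. -/
def Lagrangian (Ω : LinearMap.BilinForm ℝ E) : Type _ :=
  {L : Submodule ℝ E // IsLagrangian Ω L}

/-- Families of `dim E / 2` vectors that span a Lagrangian subspace (hence are a basis of it). -/
def LagrangianFrame (Ω : LinearMap.BilinForm ℝ E) : Type _ :=
  {b : Fin (Module.finrank ℝ E / 2) → E // IsLagrangian Ω (Submodule.span ℝ (Set.range b))}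

/-- The Lagrangian subspace spanned by a frame. -/
def LagrangianFrame.span {Ω : LinearMap.BilinForm ℝ E} (b : LagrangianFrame Ω) : Lagrangian Ω :=
  ⟨Submodule.span ℝ (Set.range b.1), b.2⟩

/-- Frames carry the subspace topology from `E × ⋯ × E`. -/
instance [TopologicalSpace E] (Ω : LinearMap.BilinForm ℝ E) :
    TopologicalSpace (LagrangianFrame Ω) :=
  inferInstanceAs (TopologicalSpace {b : Fin (Module.finrank ℝ E / 2) → E //
    IsLagrangian Ω (Submodule.span ℝ (Set.range b))})

/-- The usual (Grassmannian) topology of `Λ(E, Ω)`: the quotient topology from frames. -/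
instance [TopologicalSpace E] (Ω : LinearMap.BilinForm ℝ E) :
    TopologicalSpace (Lagrangian Ω) :=
  TopologicalSpace.coinduced LagrangianFrame.span inferInstance

/-! ### The charts of the Lagrangian Grassmannian -/

/-- If `L` is a complement of `L₁`, the linear map `T : L₀ → L₁` whose graph
`{x + T x | x ∈ L₀}` is `L`, for `L₀` a complement of `L₁` (see `mem_iff_graphMap`): minus the
projection onto `L₁` along `L`. -/
def graphMap (L₀ L₁ L : Submodule ℝ E) (h : IsCompl L L₁) : L₀ →ₗ[ℝ] L₁ :=
  -((Submodule.projectionOnto L₁ L h.symm) ∘ₗ L₀.subtype)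

theorem mem_iff_graphMap (L₀ L₁ L : Submodule ℝ E) (h₀ : IsCompl L₀ L₁) (h : IsCompl L L₁)
    (z : E) : z ∈ L ↔ ∃ x : L₀, z = (x : E) + (graphMap L₀ L₁ L h x : E) := by
  have key : ∀ x : L₀, (x : E) + (graphMap L₀ L₁ L h x : E) ∈ L := by
    intro x
    rw [← Submodule.projectionOnto_apply_eq_zero_iff h.symm, map_add]
    simp [graphMap, -Submodule.coe_projectionOnto_apply]
  constructor
  · intro hz
    obtain ⟨x, hx, y, hy, rfl⟩ := Submodule.mem_sup.1
      (h₀.sup_eq_top ▸ Submodule.mem_top : z ∈ L₀ ⊔ L₁)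
    refine ⟨⟨x, hx⟩, ?_⟩
    have h2 := L.sub_mem hz (key ⟨x, hx⟩)
    have h3 : x + y - (x + (graphMap L₀ L₁ L h ⟨x, hx⟩ : E)) ∈ L₁ := by
      rw [add_sub_add_left_eq_sub]
      exact L₁.sub_mem hy (Submodule.coe_mem _)
    have h4 := Submodule.disjoint_def.1 h.disjoint _ h2 h3
    exact sub_eq_zero.1 h4
  · rintro ⟨x, rfl⟩
    exact key x

/-- The chart `φ_{L₀,L₁}`: for complementary Lagrangians `L₀`, `L₁` and a Lagrangian `L`
transverse to `L₁`, the restriction to `L₀` of `Ω(T ·, ·)`, where `L` is the graph of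
`T : L₀ → L₁`. -/
def chart (Ω : LinearMap.BilinForm ℝ E) (L₀ L₁ L : Lagrangian Ω) (h : IsCompl L.1 L₁.1) :
    LinearMap.BilinForm ℝ L₀.1 :=
  LinearMap.compl₁₂ Ω (L₁.1.subtype ∘ₗ graphMap L₀.1 L₁.1 L.1 h) L₀.1.subtype

/-! ### The Maslov index and the Hörmander index -/

variable [TopologicalSpace E]

/-- The defining properties of the `L₀`-Maslov index: a half-integer valued homomorphism on the
fundamental groupoid of `Λ(E, Ω)` such that
`μ [γ] = ½ sign φ_{L₀,L₁}(γ 1) - ½ sign φ_{L₀,L₁}(γ 0)`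
whenever `L₁` is transverse to `L₀` and `γ` is a continuous curve of Lagrangians transverse
to `L₁`. -/
structure IsMaslovIndex (Ω : LinearMap.BilinForm ℝ E) (L₀ : Lagrangian Ω)
    (μ : ∀ L L' : Lagrangian Ω, Path.Homotopic.Quotient L L' → ℝ) : Prop where
  half_integer : ∀ (L L' : Lagrangian Ω) (p : Path.Homotopic.Quotient L L'),
    ∃ k : ℤ, μ L L' p = (k : ℝ) / 2
  map_trans : ∀ (L L' L'' : Lagrangian Ω) (p : Path.Homotopic.Quotient L L')
    (p' : Path.Homotopic.Quotient L' L''), μ L L'' (p.trans p') = μ L L' p + μ L' L'' p'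
  map_chart : ∀ (L₁ : Lagrangian Ω), IsCompl L₀.1 L₁.1 →
    ∀ (L L' : Lagrangian Ω) (γ : Path L L') (_ : ∀ t, IsCompl (γ t).1 L₁.1)
      (h : IsCompl L.1 L₁.1) (h' : IsCompl L'.1 L₁.1),
      μ L L' (Path.Homotopic.Quotient.mk γ) =
        (signForm (chart Ω L₀ L₁ L' h') : ℝ) / 2 - (signForm (chart Ω L₀ L₁ L h) : ℝ) / 2

/-- The `L₀`-Maslov index `μ_{L₀}`: the (unique) groupoid homomorphism with the defining
properties. -/
def maslovIndex (Ω : LinearMap.BilinForm ℝ E) (L₀ : Lagrangian Ω) :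
    ∀ L L' : Lagrangian Ω, Path.Homotopic.Quotient L L' → ℝ :=
  Classical.epsilon (IsMaslovIndex Ω L₀)

/-- `q` is the Hörmander index `𝔮(L₀, L₁; L₀', L₁')`: the common value of
`μ_{L₁}(γ) - μ_{L₀}(γ)` over all continuous curves `γ` from `L₀'` to `L₁'`
(and such curves exist). -/
def IsHormanderIndex (Ω : LinearMap.BilinForm ℝ E) (L₀ L₁ L₀' L₁' : Lagrangian Ω) (q : ℝ) : Prop :=
  Joined L₀' L₁' ∧
    ∀ γ : Path L₀' L₁',
      maslovIndex Ω L₁ L₀' L₁' (Path.Homotopic.Quotient.mk γ)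
        - maslovIndex Ω L₀ L₀' L₁' (Path.Homotopic.Quotient.mk γ) = q

end Lagrangians

section SymplecticGroup

variable {V : Type*} [AddCommGroup V] [Module ℝ V]

/-- The symplectic group `Sp(V, ω)`: linear automorphisms of `V` preserving `ω`. -/
def Sp (ω : LinearMap.BilinForm ℝ V) : Subgroup (V ≃ₗ[ℝ] V) where
  carrier := {φ | ∀ v w, ω (φ v) (φ w) = ω v w}
  mul_mem' := by
    intro a b ha hb v w
    simp only [LinearEquiv.mul_apply]
    rw [ha, hb]
  one_mem' := fun v w => rfl
  inv_mem' := by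
    intro a ha v w
    have h := ha (a⁻¹ v) (a⁻¹ w)
    have e : ∀ u, a (a⁻¹ u) = u := fun u => a.apply_symm_apply u
    rw [e, e] at h
    exact h.symm

/-- An element of the symplectic group as an endomorphism of `V`. -/
def Sp.toEnd {ω : LinearMap.BilinForm ℝ V} (φ : Sp ω) : Module.End ℝ V :=
  (φ.1 : V →ₗ[ℝ] V)

/-- `Sp_ψ(V, ω)`: those `Φ ∈ Sp(V, ω)` for which `Φ - ψ` is invertible. -/
def SpTransverse (ω : LinearMap.BilinForm ℝ V) (ψ : Sp ω) : Set (Sp ω) :=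
  {Φ | IsUnit (Sp.toEnd Φ - Sp.toEnd ψ)}

/-- `Sp_0(V, ω) = Sp_Id(V, ω)`: those `Φ ∈ Sp(V, ω)` for which `Φ - Id` is invertible. -/
def SpZero (ω : LinearMap.BilinForm ℝ V) : Set (Sp ω) := SpTransverse ω 1

/-- The form `ω² = ω ⊕ (-ω)` on `V × V`:
`ω²((v₁, v₂), (w₁, w₂)) = ω(v₁, w₁) - ω(v₂, w₂)`. -/
def doubleForm (ω : LinearMap.BilinForm ℝ V) : LinearMap.BilinForm ℝ (V × V) :=
  LinearMap.compl₁₂ ω (LinearMap.fst ℝ V V) (LinearMap.fst ℝ V V)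
    - LinearMap.compl₁₂ ω (LinearMap.snd ℝ V V) (LinearMap.snd ℝ V V)

theorem isLagrangian_graph [FiniteDimensional ℝ V] (ω : LinearMap.BilinForm ℝ V) (φ : Sp ω) :
    IsLagrangian (doubleForm ω) (Sp.toEnd φ).graph := by
  constructor
  · rintro ⟨x₁, x₂⟩ hx ⟨y₁, y₂⟩ hy
    rw [LinearMap.mem_graph_iff] at hx hy
    simp only at hx hy
    subst hx hy
    simpa [doubleForm, Sp.toEnd, sub_eq_zero] using (φ.2 x₁ y₁).symm
  · have h : (Sp.toEnd φ).graph = LinearMap.range (LinearMap.id.prod (Sp.toEnd φ)) :=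
      LinearMap.graph_eq_range_prod _
    have hi : Function.Injective (LinearMap.id.prod (Sp.toEnd φ)) := fun a b hab =>
      congrArg Prod.fst hab
    rw [h, LinearMap.finrank_range_of_inj hi, Module.finrank_prod, two_mul]

/-- The graph `Gr(φ) = {(v, φ v)}` as a Lagrangian subspace of `(V × V, ω²)`. -/
def Gr [FiniteDimensional ℝ V] {ω : LinearMap.BilinForm ℝ V} (φ : Sp ω) :
    Lagrangian (doubleForm ω) :=
  ⟨(Sp.toEnd φ).graph, isLagrangian_graph ω φ⟩

/-- The diagonal `Δ = {(v, v)} = Gr(Id)`. -/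
def diag [FiniteDimensional ℝ V] (ω : LinearMap.BilinForm ℝ V) : Lagrangian (doubleForm ω) :=
  Gr 1

theorem mem_diag [FiniteDimensional ℝ V] (ω : LinearMap.BilinForm ℝ V) (z : V × V) :
    z ∈ (diag ω).1 ↔ z.2 = z.1 := by
  simp only [diag, Gr, LinearMap.mem_graph_iff]
  rfl

/-- The `ψ`-Cayley transform `C_ψ(Φ) = J (ψ - Id) (Φ - ψ)⁻¹ (Φ - Id)`; `Ring.inverse` is the
inverse of endomorphisms, used only for invertible `Φ - ψ`. -/
def cayley {ω : LinearMap.BilinForm ℝ V} (J : Module.End ℝ V) (ψ Φ : Sp ω) : Module.End ℝ V :=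
  J * (Sp.toEnd ψ - 1) * Ring.inverse (Sp.toEnd Φ - Sp.toEnd ψ) * (Sp.toEnd Φ - 1)

end SymplecticGroup

end SymplecticIndex

end

open SymplecticIndex

/-!
For a Lagrangian `L₁` transverse to `L₀`, the signature of the chart `φ_{L₀,L₁}` is an integer
valued function on the open set of Lagrangians transverse to `L₁`. On the overlap of two such sets
the difference of the two functions is the signature of a *nondegenerate* form depending
continuously on the Lagrangian (`signForm_transitionForm`, `transitionForm_nondegenerate`), and is
therefore locally constant (`eventually_chartSign_sub_eq`). Since any finite family of Lagrangians
has a common transversal (`exists_common_transversal`), these sets cover the Grassmannian. Such a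
family of functions glues to a principal `ℤ`-bundle, and its monodromy is the Maslov index
(`exists_groupoid_hom`, `exists_isMaslovIndex`).

In the chart of a Lagrangian transverse to three Lagrangians with symmetric forms `A`, `A'`, `A''`,
their Kashiwara index is `sign (A - A') + sign (A' - A'') + sign (A'' - A)`
(`signForm_kashiwaraForm`). Hence, for `L₁` transverse to `L₀` and `L₀'`, the difference of the
functions belonging to `L₀'` and `L₀` is, up to a constant, a function that does not involve `L₁`;
it follows that `μ_{L₀'} - μ_{L₀}` is a coboundary (`maslovIndex_sub_maslovIndex`), so that the
Hörmander index is defined and can be computed in any single chart (`isHormanderIndex_of_isCompl`).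

For `L₀ = Δ` and `L₁ = Gr ψ` the chart is the Cayley transform (`chart_Gr`), which gives the first
formula. The second one compares two orthogonal splittings of the nondegenerate form `A ⊕ (-B)` on
`V × V` (`signOp_inverse_sub_inverse`). The algebraic tool throughout is that a subspace and its
orthogonal complement split the signature of a nondegenerate form, even if they intersect
(`signForm_eq_add_of_nondegenerate`).
-/

noncomputable section

namespace SymplecticIndex

/-! ### Signatures of bilinear forms -/

section Signature

variable {W W₁ W₂ : Type*} [AddCommGroup W] [Module ℝ W] [AddCommGroup W₁] [Module ℝ W₁]
  [AddCommGroup W₂] [Module ℝ W₂]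

open LinearMap.BilinMap (toQuadraticMap)

theorem signForm_congr {B : LinearMap.BilinForm ℝ W} {B' : LinearMap.BilinForm ℝ W₁}
    (e : W ≃ₗ[ℝ] W₁) (h : ∀ x, B' (e x) (e x) = B x x) : signForm B = signForm B' := by
  have he : (toQuadraticMap B).Equivalent (toQuadraticMap B') := ⟨⟨e, fun x => h x⟩⟩
  rw [signForm, signForm, he.sigPos_eq, he.sigNeg_eq]

theorem signForm_neg (B : LinearMap.BilinForm ℝ W) : signForm (-B) = -signForm B := by
  have h : toQuadraticMap (-B) = -toQuadraticMap B := by ext; simp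
  rw [signForm, signForm, h, sigPos_neg, sigNeg_neg]
  ring

theorem signForm_eq_zero_of_diag {B : LinearMap.BilinForm ℝ W} (h : ∀ x, B x x = 0) :
    signForm B = 0 := by
  have h1 : signForm B = signForm (-B) :=
    signForm_congr (LinearEquiv.refl ℝ W) fun x => by simp [h]
  rw [signForm_neg] at h1
  omega

theorem sigPos_toQuadraticMap_neg (B : LinearMap.BilinForm ℝ W) :
    sigPos (toQuadraticMap (-B)) = sigNeg (toQuadraticMap B) := by
  have h : toQuadraticMap (-B) = -toQuadraticMap B := by ext; simp
  rw [h, sigPos_neg]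

theorem sigNeg_toQuadraticMap_neg (B : LinearMap.BilinForm ℝ W) :
    sigNeg (toQuadraticMap (-B)) = sigPos (toQuadraticMap B) := by
  have h : toQuadraticMap (-B) = -toQuadraticMap B := by ext; simp
  rw [h, sigNeg_neg]

theorem finrank_map_of_injective {i : W₁ →ₗ[ℝ] W} (hi : Function.Injective i)
    (D : Submodule ℝ W₁) : Module.finrank ℝ (D.map i) = Module.finrank ℝ D :=
  (Submodule.equivMapOfInjective i hi D).finrank_eq.symm

variable [FiniteDimensional ℝ W] [FiniteDimensional ℝ W₁] [FiniteDimensional ℝ W₂]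

theorem finrank_le_sigPos {B : LinearMap.BilinForm ℝ W} {D : Submodule ℝ W}
    (hD : ∀ x ∈ D, x ≠ 0 → 0 < B x x) : Module.finrank ℝ D ≤ sigPos (toQuadraticMap B) :=
  le_sigPos_of_posDef _ fun x hx => hD x x.2 (by simpa using hx)

theorem exists_finrank_eq_sigPos (B : LinearMap.BilinForm ℝ W) :
    ∃ D : Submodule ℝ W, Module.finrank ℝ D = sigPos (toQuadraticMap B) ∧
      ∀ x ∈ D, x ≠ 0 → 0 < B x x := by
  obtain ⟨D, h1, h2⟩ := exists_finrank_eq_sigPos_and_posDef (toQuadraticMap B)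
  exact ⟨D, h1, fun x hx h0 => h2 ⟨x, hx⟩ (by simpa using h0)⟩

theorem sigPos_add_sigNeg_add_finrank_ker {B : LinearMap.BilinForm ℝ W}
    (hB : ∀ x y, B x y = B y x) :
    sigPos (toQuadraticMap B) + sigNeg (toQuadraticMap B) + Module.finrank ℝ (LinearMap.ker B)
      = Module.finrank ℝ W := by
  rw [← QuadraticForm.sigPos_add_sigNeg_add_radical (Q := toQuadraticMap B),
    QuadraticMap.radical_eq_ker_polarBilin]
  have : LinearMap.ker (toQuadraticMap B).polarBilin = LinearMap.ker B := by
    ext x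
    simp only [LinearMap.mem_ker, LinearMap.ext_iff, QuadraticMap.polarBilin_apply_apply,
      LinearMap.BilinMap.polar_toQuadraticMap, LinearMap.zero_apply]
    refine forall_congr' fun y => ?_
    rw [hB y x]
    constructor <;> intro h <;> linarith
  rw [this]

/-- A positive semidefinite subspace, assembled from positive definite subspaces of two orthogonal
pieces and an isotropic subspace orthogonal to both, meets every negative definite subspace
trivially. -/
theorem sigPos_add_sigPos_add_finrank_add_sigNeg_le {B : LinearMap.BilinForm ℝ W}
    {B₁ : LinearMap.BilinForm ℝ W₁} {B₂ : LinearMap.BilinForm ℝ W₂} (hB : ∀ x y, B x y = B y x)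
    {i₁ : W₁ →ₗ[ℝ] W} {i₂ : W₂ →ₗ[ℝ] W} (hi₁ : Function.Injective i₁)
    (hi₂ : Function.Injective i₂) (h₁ : ∀ x, B (i₁ x) (i₁ x) = B₁ x x)
    (h₂ : ∀ x, B (i₂ x) (i₂ x) = B₂ x x) (h₁₂ : ∀ x y, B (i₁ x) (i₂ y) = 0) {K : Submodule ℝ W}
    (hK : ∀ x ∈ K, ∀ y ∈ K, B x y = 0) (hK₁ : ∀ x, ∀ y ∈ K, B (i₁ x) y = 0)
    (hK₂ : ∀ x, ∀ y ∈ K, B (i₂ x) y = 0) :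
    sigPos (toQuadraticMap B₁) + sigPos (toQuadraticMap B₂) + Module.finrank ℝ K
      + sigNeg (toQuadraticMap B) ≤ Module.finrank ℝ W := by
  obtain ⟨D₁, hd₁, hp₁⟩ := exists_finrank_eq_sigPos B₁
  obtain ⟨D₂, hd₂, hp₂⟩ := exists_finrank_eq_sigPos B₂
  rw [← hd₁, ← hd₂, ← finrank_map_of_injective hi₁ D₁,
    ← finrank_map_of_injective hi₂ D₂]
  have e2 := Submodule.finrank_sup_add_finrank_inf_eq (D₂.map i₂) K
  have e1 := Submodule.finrank_sup_add_finrank_inf_eq (D₁.map i₁) (D₂.map i₂ ⊔ K)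
  have d2 : D₂.map i₂ ⊓ K = ⊥ := by
    rw [Submodule.eq_bot_iff]
    rintro _ ⟨⟨x, hx, rfl⟩, hk⟩
    by_contra h0
    have := hp₂ x hx (by rintro rfl; simp at h0)
    rw [← h₂, hK₂ x _ hk] at this
    exact this.false
  have d1 : D₁.map i₁ ⊓ (D₂.map i₂ ⊔ K) = ⊥ := by
    rw [Submodule.eq_bot_iff]
    rintro _ ⟨⟨x, hx, rfl⟩, hk⟩
    obtain ⟨_, ⟨y, hy, rfl⟩, k, hk, h⟩ := Submodule.mem_sup.1 hk
    by_contra h0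
    have := hp₁ x hx (by rintro rfl; simp at h0)
    rw [← h₁] at this
    nth_rewrite 2 [← h] at this
    rw [map_add, h₁₂, hK₁ x _ hk] at this
    simp at this
  rw [d2, finrank_bot] at e2
  rw [d1, finrank_bot] at e1
  have key := QuadraticForm.sigPos_add_finrank_le_of_nonpos (Q := toQuadraticMap (-B))
    (V := D₁.map i₁ ⊔ (D₂.map i₂ ⊔ K)) (by
      intro z hz
      obtain ⟨_, ⟨x, hx, rfl⟩, _, hw, rfl⟩ := Submodule.mem_sup.1 hz
      obtain ⟨_, ⟨y, hy, rfl⟩, k, hk, rfl⟩ := Submodule.mem_sup.1 hw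
      have a1 : 0 ≤ B₁ x x := by
        by_cases h : x = 0
        · simp [h]
        · exact (hp₁ x hx h).le
      have a2 : 0 ≤ B₂ y y := by
        by_cases h : y = 0
        · simp [h]
        · exact (hp₂ y hy h).le
      simp only [LinearMap.BilinMap.toQuadraticMap_apply, LinearMap.neg_apply, map_add,
        LinearMap.add_apply, h₁, h₂, h₁₂, hK₁ _ k hk, hK₂ _ k hk, hK k hk k hk,
        hB k (i₁ x), hB k (i₂ y), hB (i₂ y) (i₁ x)]
      linarith)
  rw [sigPos_toQuadraticMap_neg] at key
  omega

/-- Two orthogonal subspaces of complementary dimensions split the signature, as soon as some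
isotropic subspace orthogonal to both has the dimension required by the nullities: the estimates of
`sigPos_add_sigPos_add_finrank_add_sigNeg_le` for `B` and for `-B` then add up to an equality. -/
theorem signForm_eq_add_of_isotropic {B : LinearMap.BilinForm ℝ W}
    {B₁ : LinearMap.BilinForm ℝ W₁} {B₂ : LinearMap.BilinForm ℝ W₂} (hB : ∀ x y, B x y = B y x)
    {i₁ : W₁ →ₗ[ℝ] W} {i₂ : W₂ →ₗ[ℝ] W} (hi₁ : Function.Injective i₁)
    (hi₂ : Function.Injective i₂) (h₁ : ∀ x y, B (i₁ x) (i₁ y) = B₁ x y)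
    (h₂ : ∀ x y, B (i₂ x) (i₂ y) = B₂ x y) (h₁₂ : ∀ x y, B (i₁ x) (i₂ y) = 0) {K : Submodule ℝ W}
    (hK : ∀ x ∈ K, ∀ y ∈ K, B x y = 0) (hK₁ : ∀ x, ∀ y ∈ K, B (i₁ x) y = 0)
    (hK₂ : ∀ x, ∀ y ∈ K, B (i₂ x) y = 0)
    (hd : Module.finrank ℝ W₁ + Module.finrank ℝ W₂ = Module.finrank ℝ W)
    (hk : Module.finrank ℝ (LinearMap.ker B₁) + Module.finrank ℝ (LinearMap.ker B₂)
      + Module.finrank ℝ (LinearMap.ker B) = 2 * Module.finrank ℝ K) :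
    signForm B = signForm B₁ + signForm B₂ := by
  have a := sigPos_add_sigPos_add_finrank_add_sigNeg_le hB hi₁ hi₂ (fun x => h₁ x x)
    (fun x => h₂ x x) h₁₂ hK hK₁ hK₂
  have b := sigPos_add_sigPos_add_finrank_add_sigNeg_le (B := -B) (B₁ := -B₁) (B₂ := -B₂)
    (K := K) (fun x y => by simp [hB x y]) hi₁ hi₂ (fun x => by simp [h₁])
    (fun x => by simp [h₂]) (fun x y => by simp [h₁₂]) (fun x hx y hy => by simp [hK x hx y hy])
    (fun x y hy => by simp [hK₁ x y hy]) (fun x y hy => by simp [hK₂ x y hy])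
  rw [sigPos_toQuadraticMap_neg, sigPos_toQuadraticMap_neg, sigNeg_toQuadraticMap_neg] at b
  have c := sigPos_add_sigNeg_add_finrank_ker hB
  have c₁ := sigPos_add_sigNeg_add_finrank_ker (B := B₁) fun x y => by rw [← h₁, hB, h₁]
  have c₂ := sigPos_add_sigNeg_add_finrank_ker (B := B₂) fun x y => by rw [← h₂, hB, h₂]
  simp only [signForm]
  omega

/-- For a nondegenerate symmetric form, the signature is the sum of the signatures of the
restrictions to a subspace and to its orthogonal complement. The two subspaces, given here as the
ranges of injective maps, may intersect: the intersection `K` is isotropic and lies in a hyperbolic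
summand of dimension `2 dim K`, which does not contribute to the signature. -/
theorem signForm_eq_add_of_nondegenerate {B : LinearMap.BilinForm ℝ W}
    {B₁ : LinearMap.BilinForm ℝ W₁} {B₂ : LinearMap.BilinForm ℝ W₂} (hB : ∀ x y, B x y = B y x)
    (hB0 : ∀ x, (∀ y, B x y = 0) → x = 0)
    {i₁ : W₁ →ₗ[ℝ] W} {i₂ : W₂ →ₗ[ℝ] W} (hi₁ : Function.Injective i₁)
    (hi₂ : Function.Injective i₂) (h₁ : ∀ x y, B (i₁ x) (i₁ y) = B₁ x y)
    (h₂ : ∀ x y, B (i₂ x) (i₂ y) = B₂ x y) (h₁₂ : ∀ x y, B (i₁ x) (i₂ y) = 0)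
    (hd : Module.finrank ℝ W₁ + Module.finrank ℝ W₂ = Module.finrank ℝ W) :
    signForm B = signForm B₁ + signForm B₂ := by
  have hsymm : B.IsSymm := ⟨hB⟩
  have hker : LinearMap.ker B = ⊥ := by
    rw [Submodule.eq_bot_iff]
    exact fun x hx => hB0 x fun y => by rw [LinearMap.mem_ker.1 hx, LinearMap.zero_apply]
  have hnd : B.Nondegenerate := (hsymm.isRefl.nondegenerate_iff_separatingLeft).2
    (LinearMap.separatingLeft_iff_ker_eq_bot.2 hker)
  have r₁ := LinearMap.finrank_range_of_inj hi₁
  have r₂ := LinearMap.finrank_range_of_inj hi₂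
  have o₁ : B.orthogonal (LinearMap.range i₁) = LinearMap.range i₂ := by
    symm
    apply Submodule.eq_of_le_of_finrank_eq
    · rintro _ ⟨y, rfl⟩ _ ⟨x, rfl⟩
      exact h₁₂ x y
    · rw [LinearMap.BilinForm.finrank_orthogonal hnd]
      omega
  have o₂ : B.orthogonal (LinearMap.range i₂) = LinearMap.range i₁ := by
    symm
    apply Submodule.eq_of_le_of_finrank_eq
    · rintro _ ⟨y, rfl⟩ _ ⟨x, rfl⟩
      exact (hB _ _).trans (h₁₂ y x)
    · rw [LinearMap.BilinForm.finrank_orthogonal hnd]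
      omega
  have k₁ : (LinearMap.ker B₁).map i₁ = LinearMap.range i₁ ⊓ LinearMap.range i₂ := by
    rw [← o₁]
    ext z
    constructor
    · rintro ⟨x, hx, rfl⟩
      refine ⟨⟨x, rfl⟩, ?_⟩
      rintro _ ⟨y, rfl⟩
      change B _ _ = 0
      rw [hB, h₁, LinearMap.mem_ker.1 hx, LinearMap.zero_apply]
    · rintro ⟨⟨x, rfl⟩, hx⟩
      refine ⟨x, LinearMap.mem_ker.2 (LinearMap.ext fun y => ?_), rfl⟩
      rw [← h₁, hB]
      exact hx _ ⟨y, rfl⟩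
  have k₂ : (LinearMap.ker B₂).map i₂ = LinearMap.range i₁ ⊓ LinearMap.range i₂ := by
    rw [← o₂]
    ext z
    constructor
    · rintro ⟨x, hx, rfl⟩
      refine ⟨?_, ⟨x, rfl⟩⟩
      rintro _ ⟨y, rfl⟩
      change B _ _ = 0
      rw [hB, h₂, LinearMap.mem_ker.1 hx, LinearMap.zero_apply]
    · rintro ⟨hx, ⟨x, rfl⟩⟩
      refine ⟨x, LinearMap.mem_ker.2 (LinearMap.ext fun y => ?_), rfl⟩
      rw [← h₂, hB]
      exact hx _ ⟨y, rfl⟩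
  refine signForm_eq_add_of_isotropic hB hi₁ hi₂ h₁ h₂ h₁₂
    (K := LinearMap.range i₁ ⊓ LinearMap.range i₂) ?_ ?_ ?_ hd ?_
  · rintro _ ⟨⟨x, rfl⟩, -⟩ _ ⟨-, ⟨y, rfl⟩⟩
    exact h₁₂ x y
  · rintro x _ ⟨-, ⟨y, rfl⟩⟩
    exact h₁₂ x y
  · rintro x _ ⟨⟨y, rfl⟩, -⟩
    exact (hB _ _).trans (h₁₂ y x)
  · have f₁ := finrank_map_of_injective hi₁ (LinearMap.ker B₁)
    have f₂ := finrank_map_of_injective hi₂ (LinearMap.ker B₂)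
    rw [k₁] at f₁
    rw [k₂] at f₂
    rw [hker, finrank_bot]
    omega

/-- The signature of an orthogonal direct sum, degenerate or not, is the sum of the signatures. -/
theorem signForm_prod {B : LinearMap.BilinForm ℝ (W₁ × W₂)}
    {B₁ : LinearMap.BilinForm ℝ W₁} {B₂ : LinearMap.BilinForm ℝ W₂}
    (hB₁ : ∀ x y, B₁ x y = B₁ y x) (hB₂ : ∀ x y, B₂ x y = B₂ y x)
    (h : ∀ x y, B (x, y) (x, y) = B₁ x x + B₂ y y) :
    signForm B = signForm B₁ + signForm B₂ := by
  set B' : LinearMap.BilinForm ℝ (W₁ × W₂) :=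
    B₁.compl₁₂ (LinearMap.fst ℝ W₁ W₂) (LinearMap.fst ℝ W₁ W₂)
      + B₂.compl₁₂ (LinearMap.snd ℝ W₁ W₂) (LinearMap.snd ℝ W₁ W₂) with hB'
  have hap : ∀ z w, B' z w = B₁ z.1 w.1 + B₂ z.2 w.2 := fun z w => by simp [hB']
  have hker : LinearMap.ker B' = (LinearMap.ker B₁).prod (LinearMap.ker B₂) := by
    ext z
    simp only [LinearMap.mem_ker, Submodule.mem_prod, LinearMap.ext_iff, hap, LinearMap.zero_apply]
    exact ⟨fun hz => ⟨fun x => by simpa using hz (x, 0), fun y => by simpa using hz (0, y)⟩,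
      fun hz w => by rw [hz.1, hz.2, add_zero]⟩
  have hk0 : ∀ x, ∀ y ∈ LinearMap.ker B', B' x y = 0 := fun x y hy => by
    rw [hap, hB₁, hB₂, ← hap, LinearMap.mem_ker.1 hy, LinearMap.zero_apply]
  rw [signForm_congr (B' := B') (LinearEquiv.refl ℝ _) fun z => by simp [hap, h z.1 z.2]]
  refine signForm_eq_add_of_isotropic (i₁ := LinearMap.inl ℝ W₁ W₂) (i₂ := LinearMap.inr ℝ W₁ W₂)
    (K := LinearMap.ker B') (fun z w => by rw [hap, hap, hB₁, hB₂]) LinearMap.inl_injective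
    LinearMap.inr_injective (fun x y => by simp [hap]) (fun x y => by simp [hap])
    (fun x y => by simp [hap]) (fun x _ y hy => hk0 x y hy) (fun x y hy => hk0 _ y hy)
    (fun x y hy => hk0 _ y hy) Module.finrank_prod.symm ?_
  have e : Module.finrank ℝ (LinearMap.ker B')
      = Module.finrank ℝ (LinearMap.ker B₁) + Module.finrank ℝ (LinearMap.ker B₂) := by
    rw [hker, ← Module.finrank_prod, ← LinearMap.finrank_range_of_inj
      (f := (LinearMap.ker B₁).subtype.prodMap (LinearMap.ker B₂).subtype)
      (Subtype.val_injective.prodMap Subtype.val_injective), LinearMap.range_prodMap,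
      Submodule.range_subtype, Submodule.range_subtype]
  omega

/-- Three symmetric forms with sum zero, arranged cyclically on three copies of a space: the
substitution `(b + c, c + a, a + b)` diagonalizes. -/
theorem signForm_cyclic {W : Type*} [AddCommGroup W] [Module ℝ W] [FiniteDimensional ℝ W]
    {X Y Z : LinearMap.BilinForm ℝ W} (hX : ∀ x y, X x y = X y x) (hY : ∀ x y, Y x y = Y y x)
    (hZ : ∀ x y, Z x y = Z y x) (h0 : ∀ x y, X x y + Y x y + Z x y = 0)
    {Q : LinearMap.BilinForm ℝ ((W × W) × W)}
    (hQ : ∀ x y z, Q ((x, y), z) ((x, y), z) = X x y + Y y z + Z z x) :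
    signForm Q = signForm X + signForm Y + signForm Z := by
  let c : (W × W) × W →ₗ[ℝ] W := LinearMap.fst ℝ _ _ ∘ₗ LinearMap.fst ℝ _ _
  let a : (W × W) × W →ₗ[ℝ] W := LinearMap.snd ℝ _ _ ∘ₗ LinearMap.fst ℝ _ _
  let b : (W × W) × W →ₗ[ℝ] W := LinearMap.snd ℝ _ _
  let F : (W × W) × W →ₗ[ℝ] (W × W) × W := ((b + c).prod (c + a)).prod (a + b)
  have hF : ∀ x y z, F ((x, y), z) = ((z + x, x + y), y + z) := fun _ _ _ => rfl
  have hinj : Function.Injective F := by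
    rw [← LinearMap.ker_eq_bot, Submodule.eq_bot_iff]
    rintro ⟨⟨x, y⟩, z⟩ hu
    rw [LinearMap.mem_ker, hF] at hu
    simp only [Prod.mk_eq_zero] at hu
    obtain ⟨⟨h1, h2⟩, h3⟩ := hu
    have hx : (2 : ℝ) • x = (z + x) + (x + y) - (y + z) := by
      rw [two_smul]
      abel
    rw [h1, h2, h3, add_zero, sub_zero] at hx
    have hx : x = 0 := (smul_eq_zero.1 hx).resolve_left two_ne_zero
    rw [hx, add_zero] at h1
    rw [hx, zero_add] at h2
    rw [hx, h1, h2]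
    rfl
  let D : LinearMap.BilinForm ℝ (W × W) := X.compl₁₂ (LinearMap.fst ℝ W W) (LinearMap.fst ℝ W W)
    + Y.compl₁₂ (LinearMap.snd ℝ W W) (LinearMap.snd ℝ W W)
  have hD : ∀ u v, D u v = X u.1 v.1 + Y u.2 v.2 := fun _ _ => rfl
  have e1 : signForm Q = signForm (Q.compl₁₂ F F) :=
    (signForm_congr (LinearEquiv.ofInjectiveEndo F hinj) fun _ => rfl).symm
  have e2 : signForm (Q.compl₁₂ F F) = signForm D + signForm Z := by
    refine signForm_prod (fun u v => by rw [hD, hD, hX, hY]) hZ fun u z => ?_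
    obtain ⟨x, y⟩ := u
    rw [LinearMap.compl₁₂_apply, hF, hQ, hD]
    simp only [map_add, LinearMap.add_apply]
    have := h0 x y
    have := h0 x z
    have := h0 y z
    linarith [hX y x, hX z x, hX z y, hY y x, hY z x, hY z y, hZ y x, hZ z x, hZ z y]
  have e3 : signForm D = signForm X + signForm Y := signForm_prod hX hY fun x y => hD _ _
  rw [e1, e2, e3]

/-! ### Stability of the signature -/

open Filter Topology

variable {X : Type*} [TopologicalSpace X]

/-- Positive definiteness on a fixed subspace is an open condition, by compactness of a sphere. -/
theorem eventually_sigPos_le {B : X → LinearMap.BilinForm ℝ W}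
    (hc : ∀ v w, Continuous fun x => B x v w) (x₀ : X) :
    ∀ᶠ x in 𝓝 x₀, sigPos (toQuadraticMap (B x₀)) ≤ sigPos (toQuadraticMap (B x)) := by
  obtain ⟨D, hD, hpos⟩ := exists_finrank_eq_sigPos (B x₀)
  let d := Module.finBasis ℝ D
  let S : (Fin (Module.finrank ℝ D) → ℝ) → W := fun c => ∑ i, c i • (d i : W)
  have hS : ∀ x c, B x (S c) (S c) = ∑ i, ∑ j, c i * (c j * B x (d i) (d j)) := by
    intro x c
    simp only [S, map_sum, LinearMap.sum_apply, map_smul, LinearMap.smul_apply, smul_eq_mul,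
      Finset.mul_sum]
    rw [Finset.sum_comm]
    exact Finset.sum_congr rfl fun i _ => Finset.sum_congr rfl fun j _ => by ring
  have hSd : ∀ v : D, S (d.repr v) = v := by
    intro v
    have := congrArg D.subtype (d.sum_repr v)
    rwa [map_sum] at this
  have hSmem : ∀ c, S c ∈ D := fun c => D.sum_mem fun i _ => D.smul_mem _ (d i).2
  have hS0 : ∀ c, S c = 0 → c = 0 := by
    intro c h
    have h2 : (∑ i, c i • d i : D) = 0 := Subtype.ext (by simpa [S] using h)
    exact funext fun i => Fintype.linearIndependent_iff.1 d.linearIndependent c h2 i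
  have key : ∀ᶠ x in 𝓝 x₀, ∀ c ∈ Metric.sphere (0 : Fin (Module.finrank ℝ D) → ℝ) 1,
      0 < B x (S c) (S c) := by
    refine (isCompact_sphere _ _).eventually_forall_of_forall_eventually fun c hc1 => ?_
    have hcont : Continuous fun p : X × (Fin (Module.finrank ℝ D) → ℝ) =>
        B p.1 (S p.2) (S p.2) := by
      simp only [hS]
      refine continuous_finsetSum _ fun i _ => continuous_finsetSum _ fun j _ => ?_
      have := (hc (d i) (d j)).comp
        (continuous_fst : Continuous (Prod.fst : X × (Fin (Module.finrank ℝ D) → ℝ) → X))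
      exact ((continuous_apply i).comp continuous_snd).mul
        (((continuous_apply j).comp continuous_snd).mul this)
    refine hcont.continuousAt.eventually (lt_mem_nhds ?_)
    refine hpos _ (hSmem c) fun h => ?_
    rw [hS0 c h] at hc1
    simp at hc1
  filter_upwards [key] with x hx
  rw [← hD]
  refine finrank_le_sigPos fun v hv hv0 => ?_
  let c : Fin (Module.finrank ℝ D) → ℝ := fun i => d.repr ⟨v, hv⟩ i
  have hcv : S c = v := hSd ⟨v, hv⟩
  have hc0 : c ≠ 0 := by
    rintro h
    rw [h] at hcv
    exact hv0 (by simpa [S] using hcv.symm)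
  have hn : 0 < ‖c‖ := norm_pos_iff.2 hc0
  have h1 := hx (‖c‖⁻¹ • c) (by simp [norm_smul, hn.ne'])
  have h2 : S (‖c‖⁻¹ • c) = ‖c‖⁻¹ • v := by
    rw [← hcv]
    simp [S, Finset.smul_sum, mul_smul]
  rw [h2] at h1
  simp only [map_smul, LinearMap.smul_apply, smul_eq_mul] at h1
  have h3 : 0 < ‖c‖⁻¹ := inv_pos.2 hn
  exact (mul_pos_iff_of_pos_left h3).1 ((mul_pos_iff_of_pos_left h3).1 h1)

/-- The signature of a continuous family of symmetric forms is locally constant near a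
nondegenerate member. -/
theorem eventually_signForm_eq {B : X → LinearMap.BilinForm ℝ W}
    (hc : ∀ v w, Continuous fun x => B x v w) (hB : ∀ x v w, B x v w = B x w v) (x₀ : X)
    (hB0 : ∀ v, (∀ w, B x₀ v w = 0) → v = 0) :
    ∀ᶠ x in 𝓝 x₀, signForm (B x) = signForm (B x₀) := by
  have a := eventually_sigPos_le hc x₀
  have b := eventually_sigPos_le (B := fun x => -B x) (fun v w => (hc v w).neg) x₀
  have hker : LinearMap.ker (B x₀) = ⊥ := by
    rw [Submodule.eq_bot_iff]
    exact fun x hx => hB0 x fun y => by rw [LinearMap.mem_ker.1 hx, LinearMap.zero_apply]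
  have c₀ := sigPos_add_sigNeg_add_finrank_ker (hB x₀)
  rw [hker, finrank_bot] at c₀
  filter_upwards [a, b] with x h1 h2
  have c := sigPos_add_sigNeg_add_finrank_ker (hB x)
  rw [sigPos_toQuadraticMap_neg, sigPos_toQuadraticMap_neg] at h2
  simp only [signForm]
  omega

end Signature

/-! ### Additive invariants of the fundamental groupoid -/

section Groupoid

open Topology unitInterval

variable {X : Type*} [TopologicalSpace X]

/-- Two real valued homomorphisms on the fundamental groupoid agree if they agree on all paths
contained in one of the sets of an open cover. -/
theorem groupoid_hom_ext {ι : Type*} {U : ι → Set X} (hU : ∀ i, IsOpen (U i))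
    (hcov : ∀ x, ∃ i, x ∈ U i) {m m' : ∀ x y : X, Path.Homotopic.Quotient x y → ℝ}
    (hm : ∀ x y z (p : Path.Homotopic.Quotient x y) (q : Path.Homotopic.Quotient y z),
      m x z (p.trans q) = m x y p + m y z q)
    (hm' : ∀ x y z (p : Path.Homotopic.Quotient x y) (q : Path.Homotopic.Quotient y z),
      m' x z (p.trans q) = m' x y p + m' y z q)
    (h : ∀ i x y (γ : Path x y), (∀ t, γ t ∈ U i) →
      m x y (Path.Homotopic.Quotient.mk γ) = m' x y (Path.Homotopic.Quotient.mk γ))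
    {x y : X} (γ : Path x y) :
    m x y (Path.Homotopic.Quotient.mk γ) = m' x y (Path.Homotopic.Quotient.mk γ) := by
  let d : I → I → ℝ := fun s t => m _ _ (Path.Homotopic.Quotient.mk (γ.subpath s t))
    - m' _ _ (Path.Homotopic.Quotient.mk (γ.subpath s t))
  have hd : ∀ r s t, d r t = d r s + d s t := by
    intro r s t
    have e : Path.Homotopic.Quotient.mk (γ.subpath r t) =
        (Path.Homotopic.Quotient.mk (γ.subpath r s)).trans
          (Path.Homotopic.Quotient.mk (γ.subpath s t)) := by
      rw [← Path.Homotopic.Quotient.mk_trans]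
      exact (Path.Homotopic.Quotient.eq.2 ⟨Path.Homotopy.subpathTransSubpath γ r s t⟩).symm
    simp only [d]
    rw [e, hm, hm']
    ring
  have hloc : IsLocallyConstant fun t => d 0 t := by
    rw [IsLocallyConstant.iff_eventually_eq]
    intro s
    obtain ⟨i, hi⟩ := hcov (γ s)
    -- small order-convex neighbourhoods of `s` are mapped into `U i`
    have hn : γ ⁻¹' U i ∈ 𝓝 s := γ.continuous.continuousAt.preimage_mem_nhds ((hU i).mem_nhds hi)
    obtain ⟨ε, hε, hb⟩ := Metric.mem_nhds_iff.1 hn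
    filter_upwards [Metric.ball_mem_nhds s hε] with t ht
    have hzero : d s t = 0 := by
      refine sub_eq_zero.2 (h i _ _ _ fun r => ?_)
      have hr : γ.subpath s t r ∈ Set.range (γ.subpath s t) := ⟨r, rfl⟩
      rw [Path.range_subpath] at hr
      obtain ⟨u, hu, hur⟩ := hr
      rw [← hur]
      refine hb ?_
      rw [Metric.mem_ball, Subtype.dist_eq, Real.dist_eq] at ht ⊢
      refine lt_of_le_of_lt (Set.abs_sub_left_of_mem_uIcc (a := (s : ℝ)) (b := (t : ℝ)) ?_) ht
      rw [Set.mem_uIcc] at hu ⊢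
      exact hu
    change d 0 t = d 0 s
    rw [hd 0 s t, hzero, add_zero]
  have h01 : d 0 1 = d 0 0 := hloc.apply_eq_of_preconnectedSpace 1 0
  have h00 : d 0 0 = 0 := by
    have := hd 0 0 0
    linarith
  rw [h00] at h01
  have hγ : ∀ (x' y' : X) (hx : x' = x) (hy : y' = y),
      m x' y' (Path.Homotopic.Quotient.mk (γ.cast hx hy))
        - m' x' y' (Path.Homotopic.Quotient.mk (γ.cast hx hy)) = 0 →
      m x y (Path.Homotopic.Quotient.mk γ) = m' x y (Path.Homotopic.Quotient.mk γ) := by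
    rintro _ _ rfl rfl h0
    exact sub_eq_zero.1 h0
  refine hγ _ _ γ.source γ.target ?_
  rw [← Path.subpath_zero_one]
  exact h01

/-- The principal `ℤ`-bundle whose sections over `U i` are the functions that differ from `f i`
by a constant. -/
def heightBundle {ι : Type*} (U : ι → Set X) (hU : ∀ i, IsOpen (U i))
    (hcov : ∀ x, ∃ i, x ∈ U i) (f : ι → X → ℤ)
    (hf : ∀ i j, ∀ x ∈ U i ∩ U j, ∀ᶠ y in 𝓝 x, f i y - f j y = f i x - f j x) :
    FiberBundleCore ι X ℤ where
  baseSet := U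
  isOpen_baseSet := hU
  indexAt x := (hcov x).choose
  mem_baseSet_at x := (hcov x).choose_spec
  coordChange i j x v := v + (f i x - f j x)
  coordChange_self i x _ v := by simp
  continuousOn_coordChange i j := by
    rintro ⟨x, v⟩ ⟨hx, -⟩
    refine ContinuousAt.continuousWithinAt ?_
    refine continuous_snd.continuousAt.add ?_
    have : ContinuousAt (fun y => f i y - f j y) x := by
      refine (continuousAt_const (y := f i x - f j x)).congr ?_
      filter_upwards [hf i j x hx] with y hy using hy.symm
    exact ContinuousAt.comp (f := Prod.fst) (x := (x, v)) this continuous_fst.continuousAt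
  coordChange_comp i j k x _ v := by ring

/-- A family of local integer valued functions whose differences are locally constant integrates
to a homomorphism on the fundamental groupoid. -/
theorem exists_groupoid_hom {ι : Type*} {U : ι → Set X} (hU : ∀ i, IsOpen (U i))
    (hcov : ∀ x, ∃ i, x ∈ U i) {f : ι → X → ℤ}
    (hf : ∀ i j, ∀ x ∈ U i ∩ U j, ∀ᶠ y in 𝓝 x, f i y - f j y = f i x - f j x) :
    ∃ m : ∀ x y : X, Path.Homotopic.Quotient x y → ℤ,
      (∀ x y z (p : Path.Homotopic.Quotient x y) (q : Path.Homotopic.Quotient y z),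
        m x z (p.trans q) = m x y p + m y z q) ∧
      ∀ i x y (γ : Path x y), (∀ t, γ t ∈ U i) →
        m x y (Path.Homotopic.Quotient.mk γ) = f i y - f i x := by
  let Z := heightBundle U hU hcov f hf
  have hidx : ∀ x, x ∈ U (Z.indexAt x) := Z.mem_baseSet_at
  let π : Z.TotalSpace → X := Bundle.TotalSpace.proj
  have cov : IsCoveringMap π := FiberBundle.isCoveringMap (F := ℤ) (E := Z.Fiber)
  -- the height of a point above `x`, independent of the chart used at `x`
  let val : Z.TotalSpace → ℤ := fun e => e.2
  let H : Z.TotalSpace → ℤ := fun e => val e + f (Z.indexAt e.1) e.1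
  have hinj : ∀ e e' : Z.TotalSpace, e.1 = e'.1 → H e = H e' → e = e' := by
    rintro ⟨x, v⟩ ⟨x', v'⟩ (rfl : x = x') h
    have h2 : val ⟨x, v⟩ = val ⟨x, v'⟩ := add_right_cancel h
    have h3 : v = v' := h2
    exact congrArg (Bundle.TotalSpace.mk x) h3
  let s : ι → ℤ → X → Z.TotalSpace := fun i c x => ⟨x, c + (f i x - f (Z.indexAt x) x)⟩
  have hs : ∀ i c, ContinuousOn (s i c) (U i) := by
    intro i c
    have h1 := (Z.localTriv i).continuousOn_invFun
    have h2 : ContinuousOn (fun x : X => (x, c)) (U i) :=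
      (continuous_id.prodMk continuous_const).continuousOn
    exact h1.comp h2 fun x hx => ⟨hx, trivial⟩
  have hHs : ∀ i c x, H (s i c x) = c + f i x := by
    intro i c x
    change c + (f i x - f (Z.indexAt x) x) + f (Z.indexAt x) x = c + f i x
    ring
  have hc : ∀ i, ContinuousOn (fun e => H e - f i e.1) (π ⁻¹' U i) := by
    intro i
    have h1 := continuous_snd.comp_continuousOn (Z.localTriv i).continuousOn_toFun
    refine ContinuousOn.congr h1 fun e _ => ?_
    change val e + f (Z.indexAt e.1) e.1 - f i e.1 = val e + (f (Z.indexAt e.1) e.1 - f i e.1)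
    ring
  -- two lifts of the same path keep a constant difference of heights
  have hdiff : ∀ (x y : X) (p : Path.Homotopic.Quotient x y) (e e' : π ⁻¹' {x}),
      H (cov.monodromy p e) - H e = H (cov.monodromy p e') - H e' := by
    intro x y p e e'
    induction p with | mk γ =>
    have he : γ 0 = π e.1 := γ.source.trans e.2.symm
    have he' : γ 0 = π e'.1 := γ.source.trans e'.2.symm
    set Γ := cov.liftPath γ e.1 he
    set Γ' := cov.liftPath γ e'.1 he'
    have hΓ : ∀ t, π (Γ t) = γ t := fun t => congrFun (cov.liftPath_lifts γ e.1 he) t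
    have hΓ' : ∀ t, π (Γ' t) = γ t := fun t => congrFun (cov.liftPath_lifts γ e'.1 he') t
    have hcont : Continuous fun t => H (Γ t) - H (Γ' t) := by
      rw [continuous_iff_continuousAt]
      intro t
      have ho : IsOpen (π ⁻¹' U (Z.indexAt (γ t))) := (hU _).preimage cov.continuous
      have a : ContinuousAt (fun t' => H (Γ t') - f (Z.indexAt (γ t)) (Γ t').1) t :=
        ContinuousAt.comp (f := Γ) (g := fun e => H e - f (Z.indexAt (γ t)) e.1)
          ((hc _).continuousAt (ho.mem_nhds (by
            rw [Set.mem_preimage, hΓ]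
            exact hidx _))) Γ.continuous.continuousAt
      have a' : ContinuousAt (fun t' => H (Γ' t') - f (Z.indexAt (γ t)) (Γ' t').1) t :=
        ContinuousAt.comp (f := Γ') (g := fun e => H e - f (Z.indexAt (γ t)) e.1)
          ((hc _).continuousAt (ho.mem_nhds (by
            rw [Set.mem_preimage, hΓ']
            exact hidx _))) Γ'.continuous.continuousAt
      refine (a.sub a').congr (Filter.Eventually.of_forall fun t' => ?_)
      have : (Γ t').1 = (Γ' t').1 := (hΓ t').trans (hΓ' t').symm
      simp only [Pi.sub_apply, this]
      ring
    have h01 := (IsLocallyConstant.iff_continuous _).2 hcont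
    have h01 := h01.apply_eq_of_preconnectedSpace 1 0
    have h0 : Γ 0 = e.1 := cov.liftPath_zero γ e.1 he
    have h0' : Γ' 0 = e'.1 := cov.liftPath_zero γ e'.1 he'
    rw [h0, h0'] at h01
    change H (Γ 1) - H e.1 = H (Γ' 1) - H e'.1
    linarith
  let z : ∀ x, π ⁻¹' {x} := fun x => ⟨⟨x, (0 : ℤ)⟩, rfl⟩
  refine ⟨fun x y p => H (cov.monodromy p (z x)) - H (z x), ?_, ?_⟩
  · intro x y w p q
    have := hdiff y w q (z y) (cov.monodromy p (z x))
    simp only [this, cov.monodromy_trans_apply]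
    ring
  · intro i x y γ hγ
    have hx : x ∈ U i := by simpa using hγ 0
    let Γ : C(I, Z.TotalSpace) := ⟨fun t => s i (0 - f i x + H (z x)) (γ t),
      (hs i _).comp_continuous γ.continuous hγ⟩
    have hΓ : Γ = cov.liftPath γ (z x).1 γ.source := by
      rw [cov.eq_liftPath_iff']
      refine ⟨rfl, hinj _ _ γ.source ?_⟩
      change H (s i _ (γ 0)) = _
      rw [hHs, γ.source]
      ring
    change H (cov.liftPath γ (z x).1 γ.source 1) - _ = _
    rw [← hΓ]
    change H (s i _ (γ 1)) - _ = _
    rw [hHs, γ.target]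
    ring

end Groupoid

/-! ### Lagrangian subspaces and charts -/

section SymplecticLinearAlgebra

variable {E : Type*} [AddCommGroup E] [Module ℝ E] {Ω : LinearMap.BilinForm ℝ E}

theorem IsSymplectic.skew (hΩ : IsSymplectic Ω) (x y : E) : Ω x y = -Ω y x :=
  (hΩ.alt.neg_eq y x).symm

theorem IsSymplectic.isRefl (hΩ : IsSymplectic Ω) : Ω.IsRefl := hΩ.alt.isRefl

theorem Lagrangian.form_eq_zero (L : Lagrangian Ω) {x y : E} (hx : x ∈ L.1) (hy : y ∈ L.1) :
    Ω x y = 0 := L.2.1 x hx y hy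

theorem graphMap_eq {L₀ L₁ L : Submodule ℝ E} (h : IsCompl L L₁) {x : L₀} {y : E} (hy : y ∈ L₁)
    (hxy : (x : E) + y ∈ L) : (graphMap L₀ L₁ L h x : E) = y := by
  have h1 : Submodule.projectionOnto L₁ L h.symm ((x : E) + y) = 0 :=
    (Submodule.projectionOnto_apply_eq_zero_iff h.symm).2 hxy
  rw [map_add, Submodule.projectionOnto_apply_of_mem_left h.symm hy] at h1
  have h2 : graphMap L₀ L₁ L h x = ⟨y, hy⟩ := by
    simp only [graphMap, LinearMap.neg_apply, LinearMap.comp_apply, Submodule.subtype_apply]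
    rw [neg_eq_iff_add_eq_zero, add_comm, add_comm, h1]
  rw [h2]

theorem add_graphMap_mem {L₀ L₁ L : Submodule ℝ E} (h₀ : IsCompl L₀ L₁) (h : IsCompl L L₁)
    (x : L₀) : (x : E) + (graphMap L₀ L₁ L h x : E) ∈ L :=
  (mem_iff_graphMap L₀ L₁ L h₀ h _).2 ⟨x, rfl⟩

theorem chart_apply {L₀ L₁ L : Lagrangian Ω} (h : IsCompl L.1 L₁.1) (x y : L₀.1) :
    chart Ω L₀ L₁ L h x y = Ω (graphMap L₀.1 L₁.1 L.1 h x) y := rfl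

/-- The isomorphism `x ↦ x + T x` from `L₀` to the graph `L` of `T : L₀ → L₁`. -/
def graphEquiv {L₀ L₁ L : Submodule ℝ E} (h₀ : IsCompl L₀ L₁) (h : IsCompl L L₁) : L₀ ≃ₗ[ℝ] L :=
  LinearEquiv.ofBijective
    ((L₀.subtype + L₁.subtype ∘ₗ graphMap L₀ L₁ L h).codRestrict L (add_graphMap_mem h₀ h)) <| by
    constructor
    · rw [injective_iff_map_eq_zero]
      intro x hx
      have hx : (x : E) + (graphMap L₀ L₁ L h x : E) = 0 := congrArg Subtype.val hx
      have h2 : (x : E) ∈ L₁ := by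
        rw [eq_neg_of_add_eq_zero_left hx]
        exact L₁.neg_mem (Submodule.coe_mem _)
      exact Subtype.ext (Submodule.disjoint_def.1 h₀.disjoint _ x.2 h2)
    · rintro ⟨z, hz⟩
      obtain ⟨x, rfl⟩ := (mem_iff_graphMap L₀ L₁ L h₀ h z).1 hz
      exact ⟨x, rfl⟩

theorem coe_graphEquiv {L₀ L₁ L : Submodule ℝ E} (h₀ : IsCompl L₀ L₁) (h : IsCompl L L₁)
    (x : L₀) : (graphEquiv h₀ h x : E) = x + graphMap L₀ L₁ L h x := rfl

theorem chart_symm (hΩ : IsSymplectic Ω) {L₀ L₁ L : Lagrangian Ω} (h₀ : IsCompl L₀.1 L₁.1)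
    (h : IsCompl L.1 L₁.1) (x y : L₀.1) : chart Ω L₀ L₁ L h x y = chart Ω L₀ L₁ L h y x := by
  have h1 := L.form_eq_zero (add_graphMap_mem h₀ h x) (add_graphMap_mem h₀ h y)
  rw [map_add, map_add, LinearMap.add_apply, LinearMap.add_apply, L₀.form_eq_zero x.2 y.2,
    L₁.form_eq_zero (Submodule.coe_mem _) (Submodule.coe_mem _), hΩ.skew x] at h1
  rw [chart_apply, chart_apply]
  linarith

theorem chart_self {L₀ L₁ : Lagrangian Ω} (h : IsCompl L₀.1 L₁.1) : chart Ω L₀ L₁ L₀ h = 0 := by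
  ext x y
  rw [chart_apply, graphMap_eq h L₁.1.zero_mem (by simp)]
  simp

/-- In the chart centred at `L₀`, the pairing of two graphs is the difference of their forms. -/
theorem form_graphEquiv (hΩ : IsSymplectic Ω) {L₀ L₁ L L' : Lagrangian Ω}
    (h₀ : IsCompl L₀.1 L₁.1) (h : IsCompl L.1 L₁.1) (h' : IsCompl L'.1 L₁.1) (x y : L₀.1) :
    Ω (graphEquiv h₀ h x) (graphEquiv h₀ h' y)
      = (chart Ω L₀ L₁ L h - chart Ω L₀ L₁ L' h') x y := by
  rw [LinearMap.sub_apply, LinearMap.sub_apply, chart_symm hΩ h₀ h' x y, chart_apply, chart_apply,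
    coe_graphEquiv, coe_graphEquiv, map_add, map_add, LinearMap.add_apply, LinearMap.add_apply,
    L₀.form_eq_zero x.2 y.2,
    L₁.form_eq_zero (Submodule.coe_mem (graphMap _ _ _ h x)) (Submodule.coe_mem _), hΩ.skew x]
  ring

/-- Charts with the same `L₁` and different centres differ by a translation. -/
theorem signForm_chart (hΩ : IsSymplectic Ω) {L₀ L₁ L L' : Lagrangian Ω}
    (h₀ : IsCompl L₀.1 L₁.1) (h : IsCompl L.1 L₁.1) (h' : IsCompl L'.1 L₁.1) :
    signForm (chart Ω L L₁ L' h')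
      = signForm (chart Ω L₀ L₁ L' h' - chart Ω L₀ L₁ L h) := by
  symm
  refine signForm_congr (graphEquiv h₀ h) fun x => ?_
  have hT : (graphMap L.1 L₁.1 L'.1 h' (graphEquiv h₀ h x) : E)
      = graphEquiv h₀ h' x - graphEquiv h₀ h x := by
    refine graphMap_eq h' ?_ ?_
    · rw [coe_graphEquiv, coe_graphEquiv, add_sub_add_left_eq_sub]
      exact L₁.1.sub_mem (Submodule.coe_mem _) (Submodule.coe_mem _)
    · rw [add_sub_cancel]
      exact Submodule.coe_mem _
  rw [chart_apply, hT, map_sub, LinearMap.sub_apply,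
    L.form_eq_zero (Submodule.coe_mem _) (Submodule.coe_mem _), form_graphEquiv hΩ, sub_zero]

theorem signForm_chart_swap (hΩ : IsSymplectic Ω) {L₁ L L' : Lagrangian Ω}
    (h : IsCompl L.1 L₁.1) (h' : IsCompl L'.1 L₁.1) :
    signForm (chart Ω L L₁ L' h') = -signForm (chart Ω L' L₁ L h) := by
  rw [signForm_chart hΩ h h h', signForm_chart hΩ h h' h, ← signForm_neg]
  exact signForm_congr (LinearEquiv.refl ℝ _) fun x => neg_sub _ _

/-- The form `(x, y, z) ↦ Ω(x, y) + Ω(y, z) + Ω(z, x)` on `L × L' × L''`, whose signature is the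
Kashiwara index of the three Lagrangians. -/
def kashiwaraForm (L L' L'' : Lagrangian Ω) : LinearMap.BilinForm ℝ ((L.1 × L'.1) × L''.1) :=
  let p := L.1.subtype ∘ₗ LinearMap.fst ℝ L.1 L'.1 ∘ₗ LinearMap.fst ℝ (L.1 × L'.1) L''.1
  let p' := L'.1.subtype ∘ₗ LinearMap.snd ℝ L.1 L'.1 ∘ₗ LinearMap.fst ℝ (L.1 × L'.1) L''.1
  let p'' := L''.1.subtype ∘ₗ LinearMap.snd ℝ (L.1 × L'.1) L''.1
  Ω.compl₁₂ p p' + Ω.compl₁₂ p' p'' + Ω.compl₁₂ p'' p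

variable [FiniteDimensional ℝ E]

/-- If `L₁` is transverse to three Lagrangians, their Kashiwara index is a sum of signatures in the
chart of `L₁`. -/
theorem signForm_kashiwaraForm (hΩ : IsSymplectic Ω) {L₁ L L' L'' : Lagrangian Ω}
    (h : IsCompl L.1 L₁.1) (h' : IsCompl L'.1 L₁.1) (h'' : IsCompl L''.1 L₁.1) :
    signForm (kashiwaraForm L L' L'') = signForm (chart Ω L' L₁ L h)
      + signForm (chart Ω L'' L₁ L' h') + signForm (chart Ω L L₁ L'' h'') := by
  set A := chart Ω L L₁ L h with hA
  set A' := chart Ω L L₁ L' h' with hA'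
  set A'' := chart Ω L L₁ L'' h'' with hA''
  have sA := chart_symm hΩ h h
  have sA' := chart_symm hΩ h h'
  have sA'' := chart_symm hΩ h h''
  rw [signForm_chart hΩ h h' h, signForm_chart hΩ h h'' h', signForm_chart hΩ h h h'']
  simp only [← hA, ← hA', ← hA''] at sA sA' sA'' ⊢
  let e := ((graphEquiv h h).prodCongr (graphEquiv h h')).prodCongr (graphEquiv h h'')
  rw [← signForm_congr (B := (kashiwaraForm L L' L'').compl₁₂ e.toLinearMap e.toLinearMap) e
    fun _ => rfl]
  refine signForm_cyclic (fun x y => ?_) (fun x y => ?_) (fun x y => ?_) (fun x y => ?_)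
    fun x y z => ?_
  · exact congrArg₂ (· - ·) (sA x y) (sA' x y)
  · exact congrArg₂ (· - ·) (sA' x y) (sA'' x y)
  · exact congrArg₂ (· - ·) (sA'' x y) (sA x y)
  · simp only [LinearMap.sub_apply]
    ring
  · rw [LinearMap.compl₁₂_apply]
    exact congrArg₂ _ (congrArg₂ _ (form_graphEquiv hΩ h h h' x y) (form_graphEquiv hΩ h h' h'' y z))
      (form_graphEquiv hΩ h h'' h z x)

end SymplecticLinearAlgebra

/-! ### Common transversals -/

section Transversal

variable {E : Type*} [AddCommGroup E] [Module ℝ E] [FiniteDimensional ℝ E]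
  {Ω : LinearMap.BilinForm ℝ E}

theorem IsSymplectic.finrank_orthogonal (hΩ : IsSymplectic Ω) (I : Submodule ℝ E) :
    Module.finrank ℝ I + Module.finrank ℝ (Ω.orthogonal I) = Module.finrank ℝ E := by
  rw [LinearMap.BilinForm.finrank_orthogonal hΩ.nondegenerate]
  have := I.finrank_le
  omega

theorem IsLagrangian.orthogonal_eq (hΩ : IsSymplectic Ω) {L : Submodule ℝ E}
    (hL : IsLagrangian Ω L) : Ω.orthogonal L = L := by
  symm
  refine Submodule.eq_of_le_of_finrank_eq (fun x hx y hy => hL.1 y hy x hx) ?_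
  have := hΩ.finrank_orthogonal L
  have := hL.2
  omega

theorem IsLagrangian.mem_of_forall (hΩ : IsSymplectic Ω) {L : Submodule ℝ E}
    (hL : IsLagrangian Ω L) {x : E} (hx : ∀ y ∈ L, Ω y x = 0) : x ∈ L := by
  rw [← hL.orthogonal_eq hΩ]
  exact hx

theorem IsLagrangian.isCompl_of_disjoint {L M : Submodule ℝ E} (hL : IsLagrangian Ω L)
    (hM : IsLagrangian Ω M) (h : Disjoint L M) : IsCompl L M := by
  refine (Submodule.isCompl_iff_disjoint L M ?_).2 h
  have := hL.2
  have := hM.2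
  omega

/-- An isotropic subspace that is transverse to finitely many Lagrangians and not Lagrangian can be
enlarged: its orthogonal complement is not the union of the proper subspaces to be avoided. -/
theorem exists_isotropic_lt (hΩ : IsSymplectic Ω) {ι : Type*} [Finite ι] [Nonempty ι]
    {L : ι → Submodule ℝ E} (hL : ∀ i, IsLagrangian Ω (L i)) {I : Submodule ℝ E}
    (hI : ∀ x ∈ I, ∀ y ∈ I, Ω x y = 0) (hd : ∀ i, Disjoint (L i) I)
    (hlt : 2 * Module.finrank ℝ I ≠ Module.finrank ℝ E) :
    ∃ I' : Submodule ℝ E, I < I' ∧ (∀ x ∈ I', ∀ y ∈ I', Ω x y = 0) ∧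
      ∀ i, Disjoint (L i) I' := by
  have hle : I ≤ Ω.orthogonal I := fun x hx y hy => hI y hy x hx
  have hlt : 2 * Module.finrank ℝ I < Module.finrank ℝ E := by
    have h1 := Submodule.finrank_mono hle
    have h2 := hΩ.finrank_orthogonal I
    omega
  let p : ι → Subspace ℝ (Ω.orthogonal I) := fun i => (I ⊔ L i).comap (Ω.orthogonal I).subtype
  have hp : ⋃ i, (p i : Set (Ω.orthogonal I)) ≠ Set.univ := by
    intro hcov
    obtain ⟨i, hi⟩ := Subspace.exists_eq_top_of_iUnion_eq_univ hcov
    have h1 : Ω.orthogonal I ≤ I ⊔ L i := Submodule.comap_subtype_eq_top.1 hi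
    have h2 : Ω.orthogonal I ⊓ L i = ⊥ := by
      rw [← le_bot_iff, ← disjoint_iff.1 (hd i)]
      refine le_inf inf_le_right ?_
      rintro x ⟨hx, hxL⟩
      rw [← LinearMap.BilinForm.orthogonal_orthogonal hΩ.nondegenerate hΩ.isRefl I]
      intro y hy
      obtain ⟨u, hu, v, hv, rfl⟩ := Submodule.mem_sup.1 (h1 hy)
      have h3 : Ω u x = 0 := hx u hu
      change Ω (u + v) x = 0
      rw [map_add, LinearMap.add_apply, h3, (hL i).1 v hv x hxL, add_zero]
    have h3 := Submodule.finrank_sup_add_finrank_inf_eq (Ω.orthogonal I) (L i)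
    rw [h2, finrank_bot] at h3
    have h4 := (Ω.orthogonal I ⊔ L i).finrank_le
    have h5 := hΩ.finrank_orthogonal I
    have h6 := (hL i).2
    omega
  obtain ⟨⟨v, hv⟩, hvn⟩ := (Set.ne_univ_iff_exists_notMem _).1 hp
  have hvn : ∀ i, v ∉ I ⊔ L i := fun i hi => hvn (Set.mem_iUnion.2 ⟨i, hi⟩)
  have hvo : ∀ y ∈ I, Ω y v = 0 := hv
  have hvo' : ∀ y ∈ I, Ω v y = 0 := fun y hy => by rw [hΩ.skew, hvo y hy, neg_zero]
  refine ⟨I ⊔ Submodule.span ℝ {v}, ?_, ?_, ?_⟩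
  · refine lt_of_le_of_ne le_sup_left fun h => ?_
    obtain ⟨i⟩ := ‹Nonempty ι›
    refine hvn i (Submodule.mem_sup_left ?_)
    rw [h]
    exact Submodule.mem_sup_right (Submodule.mem_span_singleton_self v)
  · intro x hx y hy
    obtain ⟨x', hx', _, hs, rfl⟩ := Submodule.mem_sup.1 hx
    obtain ⟨y', hy', _, ht, rfl⟩ := Submodule.mem_sup.1 hy
    obtain ⟨s, rfl⟩ := Submodule.mem_span_singleton.1 hs
    obtain ⟨t, rfl⟩ := Submodule.mem_span_singleton.1 ht
    simp [hI x' hx' y' hy', hvo x' hx', hvo' y' hy', hΩ.alt v]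
  · intro i
    rw [Submodule.disjoint_def]
    intro z hz hz'
    obtain ⟨x, hx, _, hx', rfl⟩ := Submodule.mem_sup.1 hz'
    obtain ⟨s, rfl⟩ := Submodule.mem_span_singleton.1 hx'
    have hs : s = 0 := by
      by_contra hs
      refine hvn i ?_
      have h1 : s • v ∈ I ⊔ L i := by
        have := (I ⊔ L i).sub_mem (Submodule.mem_sup_right hz) (Submodule.mem_sup_left hx)
        rwa [add_sub_cancel_left] at this
      have h2 := (I ⊔ L i).smul_mem s⁻¹ h1
      rwa [inv_smul_smul₀ hs] at h2
    subst hs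
    rw [zero_smul, add_zero] at hz ⊢
    exact Submodule.disjoint_def.1 (hd i) x hz hx

theorem exists_common_transversal (hΩ : IsSymplectic Ω) {ι : Type*} [Finite ι] [Nonempty ι]
    {L : ι → Submodule ℝ E} (hL : ∀ i, IsLagrangian Ω (L i)) :
    ∃ M, IsLagrangian Ω M ∧ ∀ i, IsCompl (L i) M := by
  obtain ⟨M, ⟨hM, hd⟩, hmax⟩ := set_has_maximal_iff_noetherian.2 (inferInstance : IsNoetherian ℝ E)
    {I | (∀ x ∈ I, ∀ y ∈ I, Ω x y = 0) ∧ ∀ i, Disjoint (L i) I}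
    ⟨⊥, by simp, fun _ => disjoint_bot_right⟩
  have hML : IsLagrangian Ω M := by
    refine ⟨hM, ?_⟩
    by_contra hne
    obtain ⟨I', h1, h2, h3⟩ := exists_isotropic_lt hΩ hL hM hd hne
    exact hmax I' ⟨h2, h3⟩ h1
  exact ⟨M, hML, fun i => (hL i).isCompl_of_disjoint hML (hd i)⟩

end Transversal

/-! ### Change of the auxiliary Lagrangian in a chart -/

section Projection

variable {E : Type*} [AddCommGroup E] [Module ℝ E] {Ω : LinearMap.BilinForm ℝ E}

theorem projection_mem_left {p q : Submodule ℝ E} (h : IsCompl p q) (x : E) :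
    p.projection q h x ∈ p := (p.projectionOnto q h x).2

theorem sub_projection_mem_right {p q : Submodule ℝ E} (h : IsCompl p q) (x : E) :
    x - p.projection q h x ∈ q := by
  rw [← Submodule.projectionOnto_apply_eq_zero_iff h, map_sub,
    Submodule.projectionOnto_projection, sub_self]

theorem projection_eq_zero {p q : Submodule ℝ E} (h : IsCompl p q) {x : E} (hx : x ∈ q) :
    p.projection q h x = 0 := by
  have := (Submodule.projectionOnto_apply_eq_zero_iff h).2 hx
  exact congrArg Subtype.val this

theorem mem_of_projection_eq_zero {p q : Submodule ℝ E} (h : IsCompl p q) {x : E}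
    (hx : p.projection q h x = 0) : x ∈ q := by
  have := sub_projection_mem_right h x
  rwa [hx, sub_zero] at this

theorem form_projection_add {L₀ L₁ : Submodule ℝ E}
    (hL₀ : IsLagrangian Ω L₀) (hL₁ : IsLagrangian Ω L₁) (h : IsCompl L₀ L₁) (x y : E) :
    Ω x (L₀.projection L₁ h y) + Ω (L₀.projection L₁ h x) y = Ω x y := by
  have h1 := hL₁.1 _ (sub_projection_mem_right h x) _ (sub_projection_mem_right h y)
  have h2 := hL₀.1 _ (projection_mem_left h x) _ (projection_mem_left h y)
  simp only [map_sub, LinearMap.sub_apply] at h1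
  linarith

theorem form_projection_symm (hΩ : IsSymplectic Ω) {L₀ L₁ : Submodule ℝ E}
    (hL₀ : IsLagrangian Ω L₀) (hL₁ : IsLagrangian Ω L₁) (h : IsCompl L₀ L₁) {x y : E}
    (hxy : Ω x y = 0) : Ω x (L₀.projection L₁ h y) = Ω y (L₀.projection L₁ h x) := by
  have := form_projection_add hL₀ hL₁ h x y
  rw [hΩ.skew y]
  linarith

variable {W : Type*} [AddCommGroup W] [Module ℝ W]

/-- For a parametrization `b` of a Lagrangian `L` transverse to `L₁` and to `L₁'`, a form on
`W × L₁` whose signature is the difference of the signatures of `L` in the charts `(L₀, L₁)` and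
`(L₀, L₁')`. Unlike the forms of the charts it is always nondegenerate. -/
def transitionForm (Ω : LinearMap.BilinForm ℝ E) {L₀ L₁ L₁' : Submodule ℝ E} (h : IsCompl L₀ L₁)
    (h' : IsCompl L₀ L₁') (b : W →ₗ[ℝ] E) : LinearMap.BilinForm ℝ (W × L₁) :=
  let z := b ∘ₗ LinearMap.fst ℝ W L₁
  let y := L₁.subtype ∘ₗ LinearMap.snd ℝ W L₁
  Ω.compl₁₂ z (L₀.projection L₁ h ∘ₗ z) - Ω.compl₁₂ y z - (Ω.compl₁₂ y z).flip
    - Ω.compl₁₂ y (L₀.projection L₁' h' ∘ₗ y)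

theorem transitionForm_apply {L₀ L₁ L₁' : Submodule ℝ E} (h : IsCompl L₀ L₁)
    (h' : IsCompl L₀ L₁') (b : W →ₗ[ℝ] E) (u v : W × L₁) :
    transitionForm Ω h h' b u v = Ω (b u.1) (L₀.projection L₁ h (b v.1)) - Ω u.2 (b v.1)
      - Ω v.2 (b u.1) - Ω u.2 (L₀.projection L₁' h' v.2) := rfl

theorem transitionForm_symm (hΩ : IsSymplectic Ω) {L₀ L₁ L₁' : Submodule ℝ E}
    (h : IsCompl L₀ L₁) (h' : IsCompl L₀ L₁') (hL₀ : IsLagrangian Ω L₀) (hL₁ : IsLagrangian Ω L₁)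
    (hL₁' : IsLagrangian Ω L₁') {b : W →ₗ[ℝ] E} (hb : ∀ u v, Ω (b u) (b v) = 0) (u v : W × L₁) :
    transitionForm Ω h h' b u v = transitionForm Ω h h' b v u := by
  rw [transitionForm_apply, transitionForm_apply,
    form_projection_symm hΩ hL₀ hL₁ h (hb u.1 v.1),
    form_projection_symm hΩ hL₀ hL₁' h' (hL₁.1 u.2 u.2.2 v.2 v.2.2)]
  ring

variable [FiniteDimensional ℝ E]

/-- A linear parametrization of a complement of `L₁`, followed by the projection, parametrizes
`L₀`. -/
def projectionEquiv {L₀ L₁ : Submodule ℝ E} (h : IsCompl L₀ L₁) [FiniteDimensional ℝ W]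
    (b : W →ₗ[ℝ] E) (hd : ∀ u, b u ∈ L₁ → u = 0)
    (hW : Module.finrank ℝ W = Module.finrank ℝ L₀) : W ≃ₗ[ℝ] L₀ :=
  LinearMap.linearEquivOfInjective (L₀.projectionOnto L₁ h ∘ₗ b)
    ((injective_iff_map_eq_zero _).2 fun u hu =>
      hd u ((Submodule.projectionOnto_apply_eq_zero_iff h).1 hu)) hW

theorem coe_projectionEquiv {L₀ L₁ : Submodule ℝ E} (h : IsCompl L₀ L₁) [FiniteDimensional ℝ W]
    (b : W →ₗ[ℝ] E) (hd : ∀ u, b u ∈ L₁ → u = 0)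
    (hW : Module.finrank ℝ W = Module.finrank ℝ L₀) (u : W) :
    (projectionEquiv h b hd hW u : E) = L₀.projection L₁ h (b u) := rfl

theorem transitionForm_nondegenerate (hΩ : IsSymplectic Ω) {L₀ L₁ L₁' : Submodule ℝ E}
    (h : IsCompl L₀ L₁) (h' : IsCompl L₀ L₁') (hL₀ : IsLagrangian Ω L₀) (hL₁ : IsLagrangian Ω L₁)
    (hL₁' : IsLagrangian Ω L₁') [FiniteDimensional ℝ W] {b : W →ₗ[ℝ] E}
    (hd : ∀ u, b u ∈ L₁ → u = 0) (hd' : ∀ u, b u ∈ L₁' → u = 0)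
    (hW : Module.finrank ℝ W = Module.finrank ℝ L₀) (u : W × L₁)
    (hu : ∀ v, transitionForm Ω h h' b u v = 0) : u = 0 := by
  obtain ⟨u, y⟩ := u
  simp only [transitionForm_apply] at hu
  have hy1 : L₀.projection L₁ h (y : E) = 0 := projection_eq_zero h y.2
  -- testing against `W × 0`
  have hmem : b u - y ∈ L₀ := by
    refine hL₀.mem_of_forall hΩ fun x hx => ?_
    obtain ⟨v, hv⟩ := (projectionEquiv h b hd hW).surjective ⟨x, hx⟩
    have hv : L₀.projection L₁ h (b v) = x := congrArg Subtype.val hv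
    have h1 := hu (v, 0)
    have h2 := hL₁.1 y y.2 _ (sub_projection_mem_right h (b v))
    rw [hv] at h1 h2
    simp only [map_sub, Submodule.coe_zero, map_zero, LinearMap.zero_apply] at h1 h2 ⊢
    rw [hΩ.skew x, hΩ.skew x]
    linarith
  have hy : (y : E) = b u - L₀.projection L₁ h (b u) := by
    have h1 := Submodule.projection_apply_of_mem_left h hmem
    rw [map_sub, hy1, sub_zero] at h1
    rw [h1]
    abel
  -- testing against `0 × L₁`
  have hmem' : b u + L₀.projection L₁' h' y ∈ L₁ := by
    refine hL₁.mem_of_forall hΩ fun x hx => ?_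
    have h1 := hu (0, ⟨x, hx⟩)
    have h2 := form_projection_symm hΩ hL₀ hL₁' h' (hL₁.1 y y.2 x hx)
    simp only [map_zero, map_add] at h1 ⊢
    linarith
  have h1 := projection_eq_zero h hmem'
  rw [map_add, Submodule.projection_apply_of_mem_left h (projection_mem_left h' _), hy, map_sub,
    Submodule.projection_apply_of_mem_left h' (projection_mem_left h _), add_sub_cancel] at h1
  have hu0 : u = 0 := hd' u (mem_of_projection_eq_zero h' h1)
  subst hu0
  rw [map_zero, map_zero, sub_zero] at hy
  exact Prod.ext rfl (Subtype.ext hy)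

/-- The signature of a chart, computed in a parametrization of the Lagrangian. -/
theorem signForm_chart_eq {L₀ L₁ L : Lagrangian Ω} (h : IsCompl L₀.1 L₁.1)
    (hL : IsCompl L.1 L₁.1) [FiniteDimensional ℝ W] {b : W →ₗ[ℝ] E} (hb : ∀ u, b u ∈ L.1)
    (hd : ∀ u, b u ∈ L₁.1 → u = 0) (hW : Module.finrank ℝ W = Module.finrank ℝ L₀.1) :
    signForm (chart Ω L₀ L₁ L hL)
      = signForm (Ω.compl₁₂ b (L₀.1.projection L₁.1 h ∘ₗ b)) := by
  symm
  refine signForm_congr (projectionEquiv h b hd hW) fun u => ?_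
  rw [chart_apply, coe_projectionEquiv, graphMap_eq hL (sub_projection_mem_right h (b u)) (by
    rw [coe_projectionEquiv, add_sub_cancel]
    exact hb u), map_sub, LinearMap.sub_apply,
    L₀.form_eq_zero (projection_mem_left h _) (projection_mem_left h _), sub_zero]
  rfl

theorem signForm_transitionForm (hΩ : IsSymplectic Ω) {L₀ L₁ L₁' : Submodule ℝ E}
    (h : IsCompl L₀ L₁) (h' : IsCompl L₀ L₁') (hL₀ : IsLagrangian Ω L₀) (hL₁ : IsLagrangian Ω L₁)
    (hL₁' : IsLagrangian Ω L₁') [FiniteDimensional ℝ W] {b : W →ₗ[ℝ] E}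
    (hb : ∀ u v, Ω (b u) (b v) = 0)
    (hd : ∀ u, b u ∈ L₁ → u = 0) (hd' : ∀ u, b u ∈ L₁' → u = 0)
    (hW : Module.finrank ℝ W = Module.finrank ℝ L₀) :
    signForm (transitionForm Ω h h' b) = signForm (Ω.compl₁₂ b (L₀.projection L₁ h ∘ₗ b))
      - signForm (Ω.compl₁₂ b (L₀.projection L₁' h' ∘ₗ b)) := by
  rw [sub_eq_add_neg, ← signForm_neg]
  let q : W →ₗ[ℝ] L₁ := L₁.projectionOnto L₀ h.symm ∘ₗ b
  have hq : ∀ u, (q u : E) = b u - L₀.projection L₁ h (b u) := by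
    intro u
    have h1 := Submodule.projection_add_projection_eq_self h (b u)
    exact eq_sub_of_add_eq' h1
  have hi : ∀ u, (LinearMap.id.prod q) u = (u, q u) := fun _ => rfl
  have hadd := form_projection_add (Ω := Ω) hL₀ hL₁ h
  -- the graph of `(1 - π) ∘ b` is the orthogonal complement of `W × 0`
  refine signForm_eq_add_of_nondegenerate (transitionForm_symm hΩ h h' hL₀ hL₁ hL₁' hb)
    (transitionForm_nondegenerate hΩ h h' hL₀ hL₁ hL₁' hd hd' hW)
    (i₁ := LinearMap.inl ℝ W L₁) (i₂ := LinearMap.id.prod q) LinearMap.inl_injective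
    (fun u v huv => congrArg Prod.fst huv) ?_ ?_ ?_ ?_
  · intro u v
    rw [transitionForm_apply]
    simp
  · intro u v
    rw [transitionForm_apply]
    simp only [hi, hq, LinearMap.neg_apply,
      LinearMap.compl₁₂_apply, LinearMap.comp_apply, map_sub, LinearMap.sub_apply,
      Submodule.projection_apply_of_mem_left h' (projection_mem_left h _), hb]
    have h1 := hadd (b u) (b v)
    have h2 := hadd (b v) (b u)
    rw [hb] at h1 h2
    have h3 := hL₀.1 _ (projection_mem_left h (b u)) _ (projection_mem_left h (b v))
    have h4 := hL₀.1 _ (projection_mem_left h (b u)) _ (projection_mem_left h' (b v))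
    rw [hΩ.skew (b v)] at h2
    linarith
  · intro u v
    rw [transitionForm_apply]
    simp only [hi, hq, LinearMap.inl_apply,
      map_sub, LinearMap.sub_apply, Submodule.coe_zero, map_zero, LinearMap.zero_apply, hb]
    rw [hΩ.skew (L₀.projection L₁ h (b v))]
    have h1 := hadd (b u) (b v)
    rw [hb] at h1
    linarith
  · have := hL₀.2
    have := hL₁.2
    rw [Module.finrank_prod]
    omega

end Projection

/-! ### Topology of the Lagrangian Grassmannian -/

section Grassmannian

open Topology unitInterval

variable {E : Type*} [NormedAddCommGroup E] [NormedSpace ℝ E] {Ω : LinearMap.BilinForm ℝ E}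

theorem continuous_span : Continuous (LagrangianFrame.span : LagrangianFrame Ω → Lagrangian Ω) :=
  continuous_coinduced_rng

/-- The linear map from coordinates with respect to a frame. -/
def LagrangianFrame.toLin (b : LagrangianFrame Ω) :
    (Fin (Module.finrank ℝ E / 2) → ℝ) →ₗ[ℝ] E := Fintype.linearCombination ℝ b.1

theorem LagrangianFrame.toLin_apply (b : LagrangianFrame Ω)
    (c : Fin (Module.finrank ℝ E / 2) → ℝ) : b.toLin c = ∑ i, c i • b.1 i := rfl

theorem LagrangianFrame.continuous_toLin (c : Fin (Module.finrank ℝ E / 2) → ℝ) :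
    Continuous fun b : LagrangianFrame Ω => b.toLin c := by
  simp only [LagrangianFrame.toLin_apply]
  exact continuous_finsetSum _ fun i _ =>
    ((continuous_apply i).comp continuous_subtype_val).const_smul (c i)

theorem LagrangianFrame.range_toLin (b : LagrangianFrame Ω) :
    LinearMap.range b.toLin = b.span.1 := Fintype.range_linearCombination ℝ b.1

theorem LagrangianFrame.toLin_mem (b : LagrangianFrame Ω) (c) : b.toLin c ∈ b.span.1 := by
  rw [← b.range_toLin]
  exact ⟨c, rfl⟩

theorem IsLagrangian.finrank_eq {L : Submodule ℝ E} (hL : IsLagrangian Ω L) :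
    Module.finrank ℝ L = Module.finrank ℝ E / 2 := by
  have := hL.2
  omega

/-- The signature in the chart `(L₀, L₁)`, extended by zero outside the domain of the chart. -/
def chartSign (L₀ L₁ L : Lagrangian Ω) : ℤ :=
  open scoped Classical in if h : IsCompl L.1 L₁.1 then signForm (chart Ω L₀ L₁ L h) else 0

theorem chartSign_eq {L₀ L₁ L : Lagrangian Ω} (h : IsCompl L.1 L₁.1) :
    chartSign L₀ L₁ L = signForm (chart Ω L₀ L₁ L h) := dif_pos h

theorem LagrangianFrame.toLin_injective (b : LagrangianFrame Ω) :
    Function.Injective b.toLin := by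
  rw [← LinearMap.ker_eq_bot]
  have h1 := LinearMap.finrank_range_add_finrank_ker b.toLin
  have h2 := b.span.2.finrank_eq
  rw [b.range_toLin, h2, Module.finrank_fin_fun] at h1
  exact Submodule.finrank_eq_zero.1 (by omega)

variable [FiniteDimensional ℝ E]

theorem continuous_form (Ω : LinearMap.BilinForm ℝ E) {X : Type*} [TopologicalSpace X]
    {f g : X → E} (hf : Continuous f) (hg : Continuous g) : Continuous fun x => Ω (f x) (g x) := by
  let Ω' : E →ₗ[ℝ] E →L[ℝ] ℝ := LinearMap.toContinuousLinearMap.toLinearMap ∘ₗ Ω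
  exact (Ω'.continuous_of_finiteDimensional.comp hf).clm_apply hg

theorem LagrangianFrame.isCompl_iff (b : LagrangianFrame Ω) (L₁ : Lagrangian Ω) :
    IsCompl b.span.1 L₁.1 ↔ ∀ c, b.toLin c ∈ L₁.1 → c = 0 := by
  constructor
  · intro h c hc
    exact (injective_iff_map_eq_zero _).1 b.toLin_injective c
      (Submodule.disjoint_def.1 h.disjoint _ (b.toLin_mem c) hc)
  · intro h
    refine b.span.2.isCompl_of_disjoint L₁.2 (Submodule.disjoint_def.2 fun x hx hx1 => ?_)
    rw [← b.range_toLin] at hx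
    obtain ⟨c, rfl⟩ := hx
    rw [h c hx1, map_zero]

theorem isOpen_setOf_isCompl {L₀ L₁ : Lagrangian Ω} (h₀ : IsCompl L₀.1 L₁.1) :
    IsOpen {L : Lagrangian Ω | IsCompl L.1 L₁.1} := by
  refine isOpen_coinduced.2 ?_
  let q : E →ₗ[ℝ] L₀.1 := L₀.1.projectionOnto L₁.1 h₀
  have hq : Continuous q := q.continuous_of_finiteDimensional
  have hc : Continuous fun b : LagrangianFrame Ω => fun i => q (b.1 i) :=
    continuous_pi fun i => hq.comp ((continuous_apply i).comp continuous_subtype_val)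
  have heq : LagrangianFrame.span ⁻¹' {L : Lagrangian Ω | IsCompl L.1 L₁.1}
      = (fun b : LagrangianFrame Ω => fun i => q (b.1 i)) ⁻¹' {v | LinearIndependent ℝ v} := by
    ext b
    change IsCompl b.span.1 L₁.1 ↔ LinearIndependent ℝ fun i => q (b.1 i)
    rw [b.isCompl_iff, Fintype.linearIndependent_iff]
    refine forall_congr' fun c => ?_
    have : ∑ i, c i • q (b.1 i) = q (b.toLin c) := by
      rw [b.toLin_apply, map_sum]
      simp only [map_smul]
    rw [this, Submodule.projectionOnto_apply_eq_zero_iff, funext_iff]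
    rfl
  rw [heq]
  exact isOpen_setOfPred_linearIndependent.preimage hc

theorem chartSign_sub_chartSign (hΩ : IsSymplectic Ω) {L₀ L₁ L₁' : Lagrangian Ω}
    (h : IsCompl L₀.1 L₁.1) (h' : IsCompl L₀.1 L₁'.1) (b : LagrangianFrame Ω)
    (hb : IsCompl b.span.1 L₁.1) (hb' : IsCompl b.span.1 L₁'.1) :
    chartSign L₀ L₁ b.span - chartSign L₀ L₁' b.span
      = signForm (transitionForm Ω h h' b.toLin) := by
  have hW : Module.finrank ℝ (Fin (Module.finrank ℝ E / 2) → ℝ) = Module.finrank ℝ L₀.1 := by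
    rw [Module.finrank_fin_fun, L₀.2.finrank_eq]
  have hd := (b.isCompl_iff L₁).1 hb
  have hd' := (b.isCompl_iff L₁').1 hb'
  rw [chartSign_eq hb, chartSign_eq hb', signForm_chart_eq h hb b.toLin_mem hd hW,
    signForm_chart_eq h' hb' b.toLin_mem hd' hW]
  exact (signForm_transitionForm hΩ h h' L₀.2 L₁.2 L₁'.2
    (fun u v => b.span.form_eq_zero (b.toLin_mem u) (b.toLin_mem v)) hd hd' hW).symm

theorem eventually_chartSign_sub_eq (hΩ : IsSymplectic Ω) {L₀ L₁ L₁' : Lagrangian Ω}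
    (h : IsCompl L₀.1 L₁.1) (h' : IsCompl L₀.1 L₁'.1) {L : Lagrangian Ω}
    (hL : IsCompl L.1 L₁.1) (hL' : IsCompl L.1 L₁'.1) :
    ∀ᶠ M in 𝓝 L, chartSign L₀ L₁ M - chartSign L₀ L₁' M
      = chartSign L₀ L₁ L - chartSign L₀ L₁' L := by
  set S : Set (Lagrangian Ω) := {M | (IsCompl M.1 L₁.1 ∧ IsCompl M.1 L₁'.1) ∧
    chartSign L₀ L₁ M - chartSign L₀ L₁' M = chartSign L₀ L₁ L - chartSign L₀ L₁' L} with hS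
  have hW : Module.finrank ℝ (Fin (Module.finrank ℝ E / 2) → ℝ) = Module.finrank ℝ L₀.1 := by
    rw [Module.finrank_fin_fun, L₀.2.finrank_eq]
  have hopen : IsOpen S := by
    refine isOpen_coinduced.2 (isOpen_iff_mem_nhds.2 fun b hb => ?_)
    obtain ⟨⟨h1, h2⟩, h3⟩ := hb
    have ho := (((isOpen_setOf_isCompl h).inter (isOpen_setOf_isCompl h')).preimage
      (continuous_span (Ω := Ω))).mem_nhds (show b ∈ _ from ⟨h1, h2⟩)
    have hsig := eventually_signForm_eq
      (B := fun b : LagrangianFrame Ω => transitionForm Ω h h' b.toLin) (by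
        intro u v
        simp only [transitionForm_apply]
        have p := (L₀.1.projection L₁.1 h).continuous_of_finiteDimensional
        have cu := LagrangianFrame.continuous_toLin (Ω := Ω) u.1
        have cv := LagrangianFrame.continuous_toLin (Ω := Ω) v.1
        exact (((continuous_form Ω cu (p.comp cv)).sub (continuous_form Ω continuous_const cv)).sub
          (continuous_form Ω continuous_const cu)).sub continuous_const)
      (fun b => transitionForm_symm hΩ h h' L₀.2 L₁.2 L₁'.2
        fun u v => b.span.form_eq_zero (b.toLin_mem u) (b.toLin_mem v)) b
      (transitionForm_nondegenerate hΩ h h' L₀.2 L₁.2 L₁'.2 ((b.isCompl_iff L₁).1 h1)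
        ((b.isCompl_iff L₁').1 h2) hW)
    filter_upwards [ho, hsig] with b' hb' hs
    refine ⟨hb', ?_⟩
    rw [← h3, chartSign_sub_chartSign hΩ h h' b' hb'.1 hb'.2, hs,
      chartSign_sub_chartSign hΩ h h' b h1 h2]
  exact Filter.mem_of_superset (hopen.mem_nhds ⟨⟨hL, hL'⟩, rfl⟩) fun M hM => hM.2

/-- The Maslov index exists: near each Lagrangian the signatures in any two charts differ by a
constant, so they integrate to a homomorphism on the fundamental groupoid. -/
theorem exists_isMaslovIndex (hΩ : IsSymplectic Ω) (L₀ : Lagrangian Ω) :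
    ∃ μ, IsMaslovIndex Ω L₀ μ := by
  let ι := {L₁ : Lagrangian Ω // IsCompl L₀.1 L₁.1}
  obtain ⟨m, hm, hmU⟩ := exists_groupoid_hom (X := Lagrangian Ω) (ι := ι)
    (U := fun i => {L | IsCompl L.1 i.1.1}) (fun i => isOpen_setOf_isCompl i.2)
    (fun L => by
      obtain ⟨M, hM, hc⟩ := exists_common_transversal hΩ
        (L := fun i : Bool => if i then L₀.1 else L.1) (fun i => by cases i; exacts [L.2, L₀.2])
      exact ⟨⟨⟨M, hM⟩, hc true⟩, hc false⟩)
    (f := fun i L => chartSign L₀ i.1 L)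
    (fun i j L hL => eventually_chartSign_sub_eq hΩ i.2 j.2 hL.1 hL.2)
  refine ⟨fun L L' p => (m L L' p : ℝ) / 2, fun L L' p => ⟨m L L' p, rfl⟩, ?_, ?_⟩
  · intro L L' L'' p p'
    rw [hm]
    push_cast
    ring
  · intro L₁ h₁ L L' γ hγ h h'
    rw [hmU ⟨L₁, h₁⟩ L L' γ hγ, chartSign_eq h, chartSign_eq h']
    push_cast
    ring

theorem isMaslovIndex_maslovIndex (hΩ : IsSymplectic Ω) (L₀ : Lagrangian Ω) :
    IsMaslovIndex Ω L₀ (maslovIndex Ω L₀) :=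
  Classical.epsilon_spec (exists_isMaslovIndex hΩ L₀)

/-- The difference of two Maslov indices is the coboundary of a Kashiwara index, whence it depends
on the end points only. -/
theorem maslovIndex_sub_maslovIndex (hΩ : IsSymplectic Ω) (L₀ L₀' : Lagrangian Ω)
    {L L' : Lagrangian Ω} (γ : Path L L') :
    maslovIndex Ω L₀' L L' (Path.Homotopic.Quotient.mk γ)
        - maslovIndex Ω L₀ L L' (Path.Homotopic.Quotient.mk γ)
      = ((signForm (kashiwaraForm L₀ L₀' L) : ℝ) - signForm (kashiwaraForm L₀ L₀' L')) / 2 := by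
  have hμ := isMaslovIndex_maslovIndex hΩ L₀
  have hμ' := isMaslovIndex_maslovIndex hΩ L₀'
  let ι := {L₁ : Lagrangian Ω // IsCompl L₀.1 L₁.1 ∧ IsCompl L₀'.1 L₁.1}
  refine groupoid_hom_ext (X := Lagrangian Ω) (ι := ι) (U := fun i => {L | IsCompl L.1 i.1.1})
    (fun i => isOpen_setOf_isCompl i.2.1) (fun L => ?_)
    (m := fun L L' p => maslovIndex Ω L₀' L L' p - maslovIndex Ω L₀ L L' p)
    (m' := fun L L' _ => ((signForm (kashiwaraForm L₀ L₀' L) : ℝ)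
      - signForm (kashiwaraForm L₀ L₀' L')) / 2) (fun L L' L'' p q => ?_) (fun L L' L'' p q => ?_)
    (fun i L L' γ hγ => ?_) γ
  · obtain ⟨M, hM, hc⟩ := exists_common_transversal hΩ
      (L := fun i : Fin 3 => (![L₀, L₀', L] i).1) (fun i => (![L₀, L₀', L] i).2)
    exact ⟨⟨⟨M, hM⟩, hc 0, hc 1⟩, hc 2⟩
  · rw [hμ.map_trans, hμ'.map_trans]
    ring
  · ring
  · have h : IsCompl L.1 i.1.1 := by
      have := hγ 0
      rwa [γ.source] at this
    have h' : IsCompl L'.1 i.1.1 := by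
      have := hγ 1
      rwa [γ.target] at this
    rw [hμ.map_chart i.1 i.2.1 L L' γ hγ h h', hμ'.map_chart i.1 i.2.2 L L' γ hγ h h',
      signForm_kashiwaraForm hΩ i.2.1 i.2.2 h, signForm_kashiwaraForm hΩ i.2.1 i.2.2 h',
      signForm_chart_swap hΩ h i.2.2, signForm_chart_swap hΩ h' i.2.2]
    push_cast
    ring

/-- The domain of a chart is path connected, being an affine space in the chart. -/
theorem joined_of_isCompl (hΩ : IsSymplectic Ω) {L₁ L L' : Lagrangian Ω} (h : IsCompl L.1 L₁.1)
    (h' : IsCompl L'.1 L₁.1) : Joined L L' := by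
  let e := Module.finBasisOfFinrankEq ℝ L.1 L.2.finrank_eq
  let T := graphMap L.1 L₁.1 L'.1 h'
  let F : ℝ → L.1 →ₗ[ℝ] E := fun t => L.1.subtype + t • (L₁.1.subtype ∘ₗ T)
  have hF : ∀ t x, F t x = (x : E) + t • (T x : E) := fun _ _ => rfl
  have hspan : ∀ t, Submodule.span ℝ (Set.range fun i => F t (e i)) = LinearMap.range (F t) := by
    intro t
    rw [LinearMap.range_eq_map, ← e.span_eq, Submodule.map_span, ← Set.range_comp]
    rfl
  have hlag : ∀ t, IsLagrangian Ω (Submodule.span ℝ (Set.range fun i => F t (e i))) := by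
    intro t
    rw [hspan]
    constructor
    · rintro _ ⟨x, rfl⟩ _ ⟨y, rfl⟩
      have h1 : Ω (T x) y = Ω (T y) x := chart_symm hΩ h h' x y
      simp only [hF, map_add, LinearMap.add_apply, map_smul, LinearMap.smul_apply,
        L.form_eq_zero x.2 y.2, L₁.form_eq_zero (T x).2 (T y).2, h1, hΩ.skew x (T y)]
      simp
    · rw [LinearMap.finrank_range_of_inj, L.2.2]
      rw [injective_iff_map_eq_zero]
      intro x hx
      rw [hF] at hx
      refine Subtype.ext (Submodule.disjoint_def.1 h.disjoint _ x.2 ?_)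
      rw [eq_neg_of_add_eq_zero_left hx]
      exact L₁.1.neg_mem (L₁.1.smul_mem t (T x).2)
  let c : ℝ → LagrangianFrame Ω := fun t => ⟨fun i => F t (e i), hlag t⟩
  have hc : Continuous c := by
    refine Continuous.subtype_mk (continuous_pi fun i => ?_) _
    exact continuous_const.add (continuous_id.smul continuous_const)
  refine ⟨⟨⟨fun t : I => (c t).span, continuous_span.comp (hc.comp continuous_subtype_val)⟩,
    ?_, ?_⟩⟩
  · refine Subtype.ext ?_
    change Submodule.span ℝ (Set.range fun i => F (0 : ℝ) (e i)) = L.1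
    rw [hspan]
    ext z
    simp [hF]
  · refine Subtype.ext ?_
    change Submodule.span ℝ (Set.range fun i => F (1 : ℝ) (e i)) = L'.1
    rw [hspan]
    ext z
    rw [mem_iff_graphMap L.1 L₁.1 L'.1 h h' z, LinearMap.mem_range]
    simp only [hF, one_smul]
    exact exists_congr fun x => eq_comm

/-- The Hörmander index in a chart whose auxiliary Lagrangian is transverse to all the Lagrangians
involved. -/
theorem isHormanderIndex_of_isCompl (hΩ : IsSymplectic Ω) {L₁ L₀ L₀' L : Lagrangian Ω}
    (h₀ : IsCompl L₀.1 L₁.1) (h₀' : IsCompl L₀'.1 L₁.1) (h : IsCompl L.1 L₁.1) :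
    IsHormanderIndex Ω L₀ L₀' L₀ L
      ((1 / 2 : ℝ) * (signForm (chart Ω L₀ L₁ L h - chart Ω L₀ L₁ L₀' h₀')
        - signForm (chart Ω L₀ L₁ L h) + signForm (chart Ω L₀ L₁ L₀' h₀'))) := by
  refine ⟨joined_of_isCompl hΩ h₀ h, fun γ => ?_⟩
  rw [maslovIndex_sub_maslovIndex hΩ, signForm_kashiwaraForm hΩ h₀ h₀' h₀,
    signForm_kashiwaraForm hΩ h₀ h₀' h, signForm_chart_swap hΩ h h₀', ← signForm_chart hΩ h₀ h₀' h,
    chart_self h₀, signForm_eq_zero_of_diag (B := 0) fun _ => rfl]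
  push_cast
  ring

end Grassmannian

/-! ### Graphs of symplectic maps and Cayley transforms -/

section Cayley

section Linear

variable {V : Type*} [AddCommGroup V] [Module ℝ V] {ω : LinearMap.BilinForm ℝ V}

theorem doubleForm_apply (ω : LinearMap.BilinForm ℝ V) (z w : V × V) :
    doubleForm ω z w = ω z.1 w.1 - ω z.2 w.2 := rfl

theorem IsSymplectic.doubleForm [FiniteDimensional ℝ V] (hω : IsSymplectic ω) :
    IsSymplectic (doubleForm ω) := by
  have halt : (SymplecticIndex.doubleForm ω).IsAlt := fun z => by
    rw [doubleForm_apply, hω.alt, hω.alt, sub_zero]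
  refine ⟨halt, halt.isRefl.nondegenerate_iff_separatingLeft.2 fun z hz => ?_⟩
  refine Prod.ext (hω.nondegenerate.1 _ fun v => ?_) (hω.nondegenerate.1 _ fun v => ?_)
  · simpa [doubleForm_apply] using hz (v, 0)
  · simpa [doubleForm_apply] using hz (0, v)

theorem mem_Gr [FiniteDimensional ℝ V] (φ : Sp ω) (z : V × V) :
    z ∈ (Gr φ).1 ↔ z.2 = Sp.toEnd φ z.1 := Iff.rfl

theorem isCompl_Gr [FiniteDimensional ℝ V] {Φ ψ : Sp ω} (h : Φ ∈ SpTransverse ω ψ) :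
    IsCompl (Gr Φ).1 (Gr ψ).1 := by
  refine (Gr Φ).2.isCompl_of_disjoint (Gr ψ).2 (Submodule.disjoint_def.2 fun z h1 h2 => ?_)
  have h1 := (mem_Gr Φ z).1 h1
  have h2 := (mem_Gr ψ z).1 h2
  have h3 : z.1 = 0 := by
    obtain ⟨u, hu⟩ := h
    have h4 : (Sp.toEnd Φ - Sp.toEnd ψ) z.1 = 0 := by
      rw [LinearMap.sub_apply, ← h1, ← h2, sub_self]
    rw [← hu] at h4
    have h5 := LinearMap.congr_fun u.inv_mul z.1
    rw [Module.End.mul_apply, h4, map_zero] at h5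
    exact h5.symm
  exact Prod.ext h3 (by rw [h1, h3, map_zero]; rfl)

/-- The diagonal embedding of `V` onto `Δ`. -/
def diagEquiv [FiniteDimensional ℝ V] (ω : LinearMap.BilinForm ℝ V) : V ≃ₗ[ℝ] (diag ω).1 where
  toFun v := ⟨(v, v), (mem_diag ω _).2 rfl⟩
  map_add' _ _ := rfl
  map_smul' _ _ := rfl
  invFun z := z.1.1
  left_inv _ := rfl
  right_inv z := Subtype.ext (Prod.ext rfl ((mem_diag ω _).1 z.2).symm)

theorem isUnit_cayley {J : Module.End ℝ V} (hJ : J * J = -1) {ψ Φ : Sp ω} (hψ : ψ ∈ SpZero ω)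
    (hΦ : Φ ∈ SpTransverse ω ψ) (hΦ₀ : Φ ∈ SpZero ω) : IsUnit (cayley J ψ Φ) := by
  have h1 : IsUnit J :=
    ⟨⟨J, -J, by rw [mul_neg, hJ, neg_neg], by rw [neg_mul, hJ, neg_neg]⟩, rfl⟩
  have h2 : IsUnit (Sp.toEnd ψ - 1) := hψ
  have h3 : IsUnit (Sp.toEnd Φ - 1) := hΦ₀
  have h4 : IsUnit (Ring.inverse (Sp.toEnd Φ - Sp.toEnd ψ)) := IsUnit.ringInverse hΦ
  exact ((h1.mul h2).mul h4).mul h3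

end Linear

variable {V : Type*} [NormedAddCommGroup V] [InnerProductSpace ℝ V]
  {ω : LinearMap.BilinForm ℝ V} {J : Module.End ℝ V}

theorem signOp_eq_signForm {W : Type*} [AddCommGroup W] [Module ℝ W] {A : Module.End ℝ V}
    {B : LinearMap.BilinForm ℝ W} (e : V ≃ₗ[ℝ] W) (h : ∀ x, B (e x) (e x) = inner ℝ (A x) x) :
    signOp A = signForm B := signForm_congr e h

variable [FiniteDimensional ℝ V]

/-- The Cayley transform is the chart `(Δ, Gr ψ)` of the Lagrangian Grassmannian, read on
graphs. -/
theorem chart_Gr (hJω : ∀ v w : V, inner ℝ (J v) w = ω v w) {ψ Φ : Sp ω}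
    (hΦ : Φ ∈ SpTransverse ω ψ) (h : IsCompl (Gr Φ).1 (Gr ψ).1) (x y : V) :
    chart (doubleForm ω) (diag ω) (Gr ψ) (Gr Φ) h (diagEquiv ω x) (diagEquiv ω y)
      = inner ℝ (cayley J ψ Φ x) y := by
  set u : V := -(Ring.inverse (Sp.toEnd Φ - Sp.toEnd ψ) ((Sp.toEnd Φ - 1) x)) with hu
  have h1 : (Sp.toEnd Φ - Sp.toEnd ψ) u = -((Sp.toEnd Φ - 1) x) := by
    rw [hu, map_neg, ← Module.End.mul_apply, Ring.mul_inverse_cancel _ hΦ, Module.End.one_apply]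
  have hT : (graphMap (diag ω).1 (Gr ψ).1 (Gr Φ).1 h (diagEquiv ω x) : V × V)
      = (u, Sp.toEnd ψ u) := by
    refine graphMap_eq h ((mem_Gr ψ _).2 rfl) ((mem_Gr Φ _).2 ?_)
    change x + Sp.toEnd ψ u = Sp.toEnd Φ (x + u)
    rw [LinearMap.sub_apply, LinearMap.sub_apply, Module.End.one_apply] at h1
    rw [map_add, sub_eq_iff_eq_add.1 h1]
    abel
  rw [chart_apply, hT, doubleForm_apply]
  change ω u y - ω (Sp.toEnd ψ u) y = _
  have h2 : cayley J ψ Φ x = J (u - Sp.toEnd ψ u) := by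
    simp only [cayley, Module.End.mul_apply]
    rw [← neg_neg (Ring.inverse (Sp.toEnd Φ - Sp.toEnd ψ) ((Sp.toEnd Φ - 1) x)), ← hu, map_neg,
      LinearMap.sub_apply, Module.End.one_apply, neg_sub]
  rw [h2, hJω, map_sub, LinearMap.sub_apply]

/-- On the nondegenerate form `A ⊕ (-B)` the diagonal and `{(A⁻¹ v, B⁻¹ v)}` are orthogonal
complements of each other, with restrictions `A - B` and `A⁻¹ - B⁻¹`. -/
theorem signOp_inverse_sub_inverse {A B : Module.End ℝ V} (hA : IsUnit A) (hB : IsUnit B)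
    (sA : ∀ x y, inner ℝ (A x) y = inner ℝ (A y) x)
    (sB : ∀ x y, inner ℝ (B x) y = inner ℝ (B y) x) :
    signOp (Ring.inverse A - Ring.inverse B) = signOp (B - A) - signOp B + signOp A := by
  have cA : ∀ v, A (Ring.inverse A v) = v := fun v => by
    rw [← Module.End.mul_apply, Ring.mul_inverse_cancel _ hA, Module.End.one_apply]
  have cB : ∀ v, B (Ring.inverse B v) = v := fun v => by
    rw [← Module.End.mul_apply, Ring.mul_inverse_cancel _ hB, Module.End.one_apply]
  have cA' : ∀ v, Ring.inverse A (A v) = v := fun v => by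
    rw [← Module.End.mul_apply, Ring.inverse_mul_cancel _ hA, Module.End.one_apply]
  have cB' : ∀ v, Ring.inverse B (B v) = v := fun v => by
    rw [← Module.End.mul_apply, Ring.inverse_mul_cancel _ hB, Module.End.one_apply]
  let form : Module.End ℝ V → LinearMap.BilinForm ℝ V := fun C => innerₗ V ∘ₗ C
  have hform : ∀ C x y, form C x y = inner ℝ (C x) y := fun _ _ _ => rfl
  let Q : LinearMap.BilinForm ℝ (V × V) :=
    (form A).compl₁₂ (LinearMap.fst ℝ V V) (LinearMap.fst ℝ V V)
      + (form (-B)).compl₁₂ (LinearMap.snd ℝ V V) (LinearMap.snd ℝ V V)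
  have hQ : ∀ z w, Q z w = inner ℝ (A z.1) w.1 - inner ℝ (B z.2) w.2 := fun z w => by
    change inner ℝ (A z.1) w.1 + inner ℝ (-B z.2) w.2 = _
    rw [inner_neg_left, sub_eq_add_neg]
  have hneg : ∀ C, signForm (form (-C)) = -signOp C := fun C => by
    rw [signOp, ← signForm_neg]
    exact signForm_congr (LinearEquiv.refl ℝ V) fun x => (inner_neg_left _ _).symm
  have e1 : signForm Q = signOp A + signForm (form (-B)) := by
    refine signForm_prod sA (fun x y => ?_) fun x y => rfl
    rw [hform, hform, LinearMap.neg_apply, LinearMap.neg_apply, inner_neg_left, inner_neg_left, sB]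
  have e2 : signForm Q = signForm (form (A - B)) + signOp (Ring.inverse A - Ring.inverse B) := by
    refine signForm_eq_add_of_nondegenerate (i₁ := LinearMap.id.prod LinearMap.id)
      (i₂ := (Ring.inverse A).prod (Ring.inverse B)) (fun z w => ?_) (fun z hz => ?_)
      (fun x y h => congrArg Prod.fst h) (fun x y h => ?_) (fun x y => ?_) (fun x y => ?_)
      (fun x y => ?_) Module.finrank_prod.symm
    · rw [hQ, hQ, sA, sB]
    · have hz1 : A z.1 = 0 := by
        have := hz (A z.1, 0)
        rwa [hQ, inner_zero_right, sub_zero, inner_self_eq_zero] at this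
      have hz2 : B z.2 = 0 := by
        have := hz (0, B z.2)
        rwa [hQ, inner_zero_right, zero_sub, neg_eq_zero, inner_self_eq_zero] at this
      exact Prod.ext (by rw [← cA' z.1, hz1, map_zero]; rfl) (by rw [← cB' z.2, hz2, map_zero]; rfl)
    · have h1 : Ring.inverse A x = Ring.inverse A y := congrArg Prod.fst h
      rw [← cA x, h1, cA]
    · rw [hQ]
      change inner ℝ (A x) y - inner ℝ (B x) y = inner ℝ ((A - B) x) y
      rw [LinearMap.sub_apply, inner_sub_left]
    · rw [hQ]
      change inner ℝ (A (Ring.inverse A x)) (Ring.inverse A y)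
        - inner ℝ (B (Ring.inverse B x)) (Ring.inverse B y)
          = inner ℝ ((Ring.inverse A - Ring.inverse B) x) y
      rw [sA, sB, cA, cB, LinearMap.sub_apply, inner_sub_left, real_inner_comm, sub_right_inj,
        real_inner_comm]
    · rw [hQ]
      change inner ℝ (A x) (Ring.inverse A y) - inner ℝ (B x) (Ring.inverse B y) = 0
      rw [sA, sB, cA, cB, sub_self]
  have e3 : signForm (form (A - B)) = -signOp (B - A) := by
    rw [← hneg, neg_sub]
  rw [hneg] at e1
  omega

end Cayley

end SymplecticIndex

end


theorem proposition3p6 {V : Type*} [NormedAddCommGroup V] [InnerProductSpace ℝ V]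
    [FiniteDimensional ℝ V] (ω : LinearMap.BilinForm ℝ V) (hω : IsSymplectic ω)
    (J : Module.End ℝ V) (hJ : J * J = -1) (hJω : ∀ v w : V, inner ℝ (J v) w = ω v w)
    (ψ φ₁ φ₂ : Sp ω) (hψ : ψ ∈ SpZero ω)
    (hφ₁ : φ₁ ∈ SpTransverse ω ψ) (hφ₂ : φ₂ ∈ SpTransverse ω ψ) :
    IsHormanderIndex (doubleForm ω) (diag ω) (Gr φ₁) (diag ω) (Gr φ₂)
        ((1 / 2 : ℝ) * ((signOp (cayley J ψ φ₂ - cayley J ψ φ₁) : ℝ)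
          - (signOp (cayley J ψ φ₂) : ℝ) + (signOp (cayley J ψ φ₁) : ℝ))) ∧
      (φ₁ ∈ SpZero ω → φ₂ ∈ SpZero ω →
        IsUnit (cayley J ψ φ₁) ∧ IsUnit (cayley J ψ φ₂) ∧
        IsHormanderIndex (doubleForm ω) (diag ω) (Gr φ₁) (diag ω) (Gr φ₂)
          ((1 / 2 : ℝ) * (signOp
            (Ring.inverse (cayley J ψ φ₁) - Ring.inverse (cayley J ψ φ₂)) : ℝ))) := by
  have hΩ := hω.doubleForm
  have h₀ : IsCompl (diag ω).1 (Gr ψ).1 := (isCompl_Gr (ψ := 1) hψ).symm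
  have h₁ := isCompl_Gr hφ₁
  have h₂ := isCompl_Gr hφ₂
  have c₁ := chart_Gr hJω hφ₁ h₁
  have c₂ := chart_Gr hJω hφ₂ h₂
  have main := isHormanderIndex_of_isCompl hΩ h₀ h₁ h₂
  rw [← signOp_eq_signForm (diagEquiv ω) fun x => c₁ x x,
    ← signOp_eq_signForm (diagEquiv ω) fun x => c₂ x x,
    ← signOp_eq_signForm (A := cayley J ψ φ₂ - cayley J ψ φ₁) (diagEquiv ω) fun x => by
      have := congrArg₂ (· - ·) (c₂ x x) (c₁ x x)
      rwa [← inner_sub_left] at this] at main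
  refine ⟨main, fun hz₁ hz₂ => ?_⟩
  have u₁ := isUnit_cayley hJ hψ hφ₁ hz₁
  have u₂ := isUnit_cayley hJ hψ hφ₂ hz₂
  refine ⟨u₁, u₂, ?_⟩
  rw [signOp_inverse_sub_inverse u₁ u₂
    (fun x y => by rw [← c₁, ← c₁, chart_symm hΩ h₀ h₁])
    (fun x y => by rw [← c₂, ← c₂, chart_symm hΩ h₀ h₂])]
  push_cast
  exact main
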